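/- Let $n\ge 2$. Write $B=B_2^n$ for the closed Euclidean unit ball of $\mathbb{R}^n$ centred at the origin, $S^{n-1}$ for the unit sphere, $\mathcal H^{n-1}$ for the $(n-1)$-dimensional Hausdorff measure (normalised to agree with Lebesgue measure on hyperplanes) and $\sigma$ for $\mathcal H^{n-1}$ on $S^{n-1}$. For a convex body $K\subset\mathbb{R}^n$ let $h_K(u)=\max_{z\in K}\langle z,u\rangle$ be its support function and $\beta(K)=\min_{u\in S^{n-1}}h_K(u)$. If $K$ contains the origin in its interior and $p\in\mathbb{R}$, $p\neq -n$, the $L_p$ affine surface area of $K$ is $$as_p(K)=\int_{\partial K}\frac{H_{n-1}(x)^{\frac{p}{n+p}}}{\langle x,\nu(x)\rangle^{\frac{n(p-1)}{n+p}}}\,d\mathcal H^{n-1}(x)\in[0,\infty],$$ where $\nu(x)$ is the outer unit normal and $H_{n-1}(x)$ the (generalised) Gauss curvature of $\partial K$ at $x$, both of which exist for almost every $x\in\partial K$, and where $0^0=1$ and $0^{a}=\infty$ for $a<0$. For $\alpha\in\mathbb{R}$ and an integer $m\ge 0$ let $\binom{\alpha}{m}=\frac{\alpha(\alpha-1)\cdots(\alpha-m+1)}{m!}$.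 **Theorem.** Let $P\subset\mathbb{R}^n$ be a convex polytope, let $\mathrm{vert}\,P$ be the set of its vertices, and for $v\in\mathrm{vert}\,P$ let $\mathrm{Norm}(v)=\{u\in\mathbb{R}^n:\langle u,z-v\rangle\le 0\text{ for all }z\in P\}$ be the normal cone of $P$ at $v$. Let $0\le t<\beta(P)$ (so that, in particular, the origin is an interior point of $P$). (i) Let $p\in\mathbb{R}\setminus[-n,0]$, and assume $t>0$ if $p<-n$. Then $as_p(P+tB)<\infty$ and $$as_p(P+tB)=\sum_{m=0}^\infty\binom{\frac{n(1-p)}{n+p}}{m}\left(\sum_{v\in\mathrm{vert}\,P}\ \int_{S^{n-1}\cap\mathrm{Norm}(v)}h_P(u)^{\frac{n(1-p)}{n+p}-m}\,d\sigma(u)\right)t^{\,m+\frac{n(n-1)}{n+p}},$$ where all the integrals are finite and the series converges absolutely. (ii) If $p\in(-n,0)$, then $as_p(P+tB)=\infty$. (iii) If $p=0$, then $as_0(P+tB)=n\,\mathrm{vol}_n(P+tB)$. -/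

import Mathlib

open MeasureTheory Set Filter Topology Asymptotics Metric
open scoped Pointwise ENNReal

noncomputable section

namespace LpSteiner

/-- Euclidean space `ℝⁿ`. -/
abbrev E (n : ℕ) : Type := EuclideanSpace ℝ (Fin n)

/-- The closed Euclidean unit ball `B₂ⁿ`, centred at the origin. -/
def unitBall (n : ℕ) : Set (E n) := closedBall 0 1

/-- The Euclidean unit sphere `Sⁿ⁻¹`. -/
def unitSphere (n : ℕ) : Set (E n) := sphere 0 1

/-- The `(n-1)`-dimensional Hausdorff measure on `ℝⁿ` (for `1 ≤ n`), normalised so that it agrees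
with Lebesgue measure on hyperplanes. It gives both the surface area measure on the boundary of a
convex body and the measure `σ` on the unit sphere. -/
def surfaceMeasure (n : ℕ) : Measure (E n) := Measure.euclideanHausdorffMeasure (n - 1)

/-- A convex polytope: the convex hull of finitely many points. -/
def IsConvexPolytope {n : ℕ} (P : Set (E n)) : Prop :=
  ∃ V : Finset (E n), P = convexHull ℝ (V : Set (E n))

/-- The set of vertices (extreme points) of `P`. -/
def vert {n : ℕ} (P : Set (E n)) : Set (E n) := P.extremePoints ℝ

/-- The normal cone of `P` at `v`. -/
def normalCone {n : ℕ} (P : Set (E n)) (v : E n) : Set (E n) :=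
  {u | ∀ z ∈ P, inner ℝ u (z - v) ≤ 0}

/-- The support function `h_K(u) = sup_{z ∈ K} ⟨z, u⟩`. -/
def supportFn {n : ℕ} (K : Set (E n)) (u : E n) : ℝ :=
  sSup ((fun z => inner ℝ z u) '' K)

/-- `β(K) = min_{u ∈ Sⁿ⁻¹} h_K(u)`. (For bounded nonempty `K` and `1 ≤ n` the function `h_K` is
continuous and the infimum over the sphere is attained.) -/
def beta {n : ℕ} (K : Set (E n)) : ℝ :=
  sInf (supportFn K '' unitSphere n)

/-- `u` is an outer unit normal vector of `K` at the point `x`. -/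
def IsOuterUnitNormal {n : ℕ} (K : Set (E n)) (x u : E n) : Prop :=
  ‖u‖ = 1 ∧ ∀ z ∈ K, inner ℝ u (z - x) ≤ 0

open Classical in
/-- The Gauss map `ν`: the outer unit normal vector of `K` at the boundary point `x`, if it is
unique (which is the case at almost every boundary point of a convex body), and `0` otherwise. -/
def outerNormal {n : ℕ} (K : Set (E n)) (x : E n) : E n :=
  if h : ∃! u, IsOuterUnitNormal K x u then h.choose else 0

/-- `S` is the Weingarten map (second fundamental form) of the boundary of `K` at `x`, where `u` is
an outer unit normal at `x` and `u^⊥` is the tangent hyperplane: `S` is a self-adjoint map of `u^⊥`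
and, for boundary points `y → x`, the depth of `y` below the tangent hyperplane has the
second-order expansion `⟨u, x - y⟩ = ½ ⟨S w, w⟩ + o(|y - x|²)`, where `w` is the orthogonal
projection of `y - x` onto `u^⊥`. If the boundary of `K` is of class `C²` near `x`, this `S` is the
differential at `x` of the Gauss map, and its eigenvalues are the principal curvatures; for a
general convex body, the points that admit such an `S` are the (normal) points of second-order
differentiability of the boundary, and almost every boundary point is one. -/
structure IsWeingartenMap {n : ℕ} (K : Set (E n)) (x u : E n)
    (S : (Submodule.span ℝ {u})ᗮ →ₗ[ℝ] (Submodule.span ℝ {u})ᗮ) : Prop where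
  normal : IsOuterUnitNormal K x u
  symmetric : S.IsSymmetric
  expansion :
    (fun y : E n => inner ℝ u (x - y) -
        (1 / 2 : ℝ) * inner ℝ (S ((Submodule.span ℝ {u})ᗮ.orthogonalProjectionOnto (y - x)))
          ((Submodule.span ℝ {u})ᗮ.orthogonalProjectionOnto (y - x)))
      =o[𝓝[frontier K] x] (fun y : E n => ‖y - x‖ ^ 2)

open Classical in
/-- The (generalised) Gauss curvature `H_{n-1}(x)` of the boundary of `K` at `x`: the determinant of
the Weingarten map, i.e. the product of the principal curvatures. It is given the value `0` at the
points (for a convex body: a null set of the boundary) where there is no Weingarten map. -/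
def gaussCurvature {n : ℕ} (K : Set (E n)) (x : E n) : ℝ :=
  if h : ∃ S, IsWeingartenMap K x (outerNormal K x) S then LinearMap.det h.choose else 0

/-- The `L_p` affine surface area, for real `p ≠ -n`,
`as_p(K) = ∫_{∂K} H_{n-1}(x)^{p/(n+p)} / ⟨x, ν(x)⟩^{n(p-1)/(n+p)} dℋ^{n-1}(x)`,
as an element of `[0, ∞]`. Powers are those of `[0, ∞]`: `0 ^ a` is `0` for `a > 0`, `1` for
`a = 0`, and `∞` for `a < 0`. -/
def Lpasa {n : ℕ} (p : ℝ) (K : Set (E n)) : ℝ≥0∞ :=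
  ∫⁻ x in frontier K,
    ENNReal.ofReal (gaussCurvature K x) ^ (p / (n + p)) /
      ENNReal.ofReal (inner ℝ x (outerNormal K x)) ^ (n * (p - 1) / (n + p))
    ∂(surfaceMeasure n)

end LpSteiner

end

namespace LpSteiner

/-! ### Hausdorff measure under Lipschitz and expanding maps. -/

section HausdorffTools

open scoped NNReal

variable {X Y : Type*} [MetricSpace X] [MeasurableSpace X] [BorelSpace X]
  [MetricSpace Y] [MeasurableSpace Y] [BorelSpace Y]

/-! Write `K = P + tB`. Every boundary point of `K` has the form `y + tu` with `y ∈ P` and `u` a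
unit normal of `P` at `y`; for `t > 0` the point determines both `y` and `u`, and `u` is its only
outer normal.

If `y` is not a vertex, then `P` contains a segment through `y`, necessarily orthogonal to `u`, and
its translate lies in `∂K`. The second fundamental form is positive semidefinite and vanishes along
that segment, so the curvature is `0` (`gaussCurvature_parallel_of_not_vert`). For `p` outside `[-n,
0]` the curvature has the positive exponent `p/(n+p)`, so such points contribute nothing. If `y` is
a vertex `v`, then for almost every `u` in its normal cone `∂K` coincides near the point with the
sphere of radius `t` about `v`; the curvature is `t^{-(n-1)}` and `⟨x, ν⟩ = h_P(u) + t`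
(`gaussCurvature_spherical`). Substituting `x = v + tu` gives a power of `t` times the sum over `v`
of the integrals of `(h_P + t)^a`, with `a = n(1-p)/(n+p)` (`Lpasa_parallel_eq_sum`). Since `t <
β(P) ≤ h_P`, the binomial series can be integrated term by term (`hasSum_integral_binomial`).

For `-n < p < 0` the exponent of the curvature is negative, while the translated facets have zero
curvature and positive area, so the integral is infinite. For `p = 0` the integrand is `⟨x, ν⟩`, and
the claim is the cone volume formula `setLIntegral_inner_outerNormal`. That formula is proved by
comparing small boundary patches with flat ones; it also gives the finiteness of `σ` and the
existence of a facet of positive area. -/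

lemma euclideanHausdorffMeasure_image_le {f : X → Y} {s : Set X} {C : ℝ≥0}
    (h : LipschitzOnWith C f s) (d : ℕ) :
    (μHE[d] : Measure Y) (f '' s) ≤ (C : ℝ≥0∞) ^ d * (μHE[d] : Measure X) s := by
  simp_rw [Measure.euclideanHausdorffMeasure_def, Measure.smul_apply, ENNReal.smul_def,
    smul_eq_mul]
  have := h.hausdorffMeasure_image_le (d := d) (by positivity)
  rw [ENNReal.rpow_natCast] at this
  rw [mul_left_comm]
  gcongr

/-- The hypothesis makes `f` injective on `s` with a `C`-Lipschitz inverse, to which the previous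
bound applies. -/
lemma euclideanHausdorffMeasure_le_image {f : X → Y} {s : Set X} {C : ℝ≥0}
    (h : ∀ x ∈ s, ∀ y ∈ s, dist x y ≤ C * dist (f x) (f y)) (d : ℕ) :
    (μHE[d] : Measure X) s ≤ (C : ℝ≥0∞) ^ d * (μHE[d] : Measure Y) (f '' s) := by
  rcases s.eq_empty_or_nonempty with rfl | ⟨x₀, hx₀⟩
  · simp
  have : Nonempty X := ⟨x₀⟩
  have hinj : InjOn f s := fun x hx y hy hxy => by
    have := h x hx y hy
    rw [hxy, dist_self, mul_zero] at this
    exact dist_le_zero.1 this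
  have hinv := hinj.leftInvOn_invFunOn
  have hl : LipschitzOnWith C (Function.invFunOn f s) (f '' s) := by
    refine LipschitzOnWith.of_dist_le_mul ?_
    rintro _ ⟨x, hx, rfl⟩ _ ⟨y, hy, rfl⟩
    rw [hinv hx, hinv hy]
    exact h x hx y hy
  have := euclideanHausdorffMeasure_image_le hl d
  rwa [hinv.image_image] at this

end HausdorffTools

/-! ### From local to global comparison of measures. -/

section LocalComparison

/-- By the Lindelöf property countably many of the neighbourhoods cover `s`; making them disjoint
gives a measurable partition over which the inequalities add up. -/
lemma measure_le_of_locally_le {X : Type*} [TopologicalSpace X] [SecondCountableTopology X]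
    [MeasurableSpace X] [BorelSpace X] {μ ν : Measure X} {s : Set X} (hs : MeasurableSet s)
    (h : ∀ x ∈ s, ∃ U ∈ 𝓝 x, ∀ A, MeasurableSet A → A ⊆ U ∩ s → μ A ≤ ν A) : μ s ≤ ν s := by
  choose! U hU hA using h
  obtain ⟨c, hcs, hc, hcov⟩ := TopologicalSpace.countable_cover_nhdsWithin
    (f := fun x => interior (U x)) (s := s)
    (fun x hx => mem_nhdsWithin_of_mem_nhds (interior_mem_nhds.2 (hU x hx)))
  rcases c.eq_empty_or_nonempty with rfl | hne
  · simp only [mem_empty_iff_false, iUnion_of_empty, iUnion_empty, subset_empty_iff] at hcov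
    simp [hcov]
  obtain ⟨e, rfl⟩ := hc.exists_eq_range hne
  have hse : s = ⋃ i, s ∩ disjointed (fun i => interior (U (e i))) i := by
    rw [← inter_iUnion, iUnion_disjointed]
    rw [biUnion_range] at hcov
    exact (inter_eq_left.2 hcov).symm
  have hm : ∀ i, MeasurableSet (s ∩ disjointed (fun i => interior (U (e i))) i) := fun i =>
    hs.inter (MeasurableSet.disjointed (fun i => isOpen_interior.measurableSet) i)
  have hd : Pairwise (Function.onFun Disjoint
      fun i => s ∩ disjointed (fun i => interior (U (e i))) i) := fun i j hij =>
    (disjoint_disjointed _ hij).mono inter_subset_right inter_subset_right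
  rw [hse, measure_iUnion hd hm, measure_iUnion hd hm]
  refine ENNReal.tsum_le_tsum fun i => hA (e i) (hcs ⟨i, rfl⟩) _ (hm i) ?_
  rw [inter_comm]
  exact inter_subset_inter_left _ ((disjointed_subset _ i).trans interior_subset)

lemma ENNReal_le_of_forall_one_lt_mul {a b : ℝ≥0∞}
    (h : ∀ c : ℝ, 1 < c → a ≤ ENNReal.ofReal c * b) : a ≤ b := by
  by_cases hb : b = ∞
  · simp [hb]
  have ht : Tendsto (fun c : ℝ => ENNReal.ofReal c * b) (𝓝[>] 1) (𝓝 (ENNReal.ofReal 1 * b)) :=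
    ENNReal.Tendsto.mul_const ((ENNReal.continuous_ofReal.tendsto 1).mono_left nhdsWithin_le_nhds)
      (Or.inr hb)
  rw [ENNReal.ofReal_one, one_mul] at ht
  exact ge_of_tendsto ht (eventually_mem_nhdsWithin.mono h)

end LocalComparison

/-! ### Cones over flat bases. -/

section Cone

/-- The cone with apex at the origin (and without the apex) over `A`. -/
def cone {n : ℕ} (A : Set (E n)) : Set (E n) := {z | ∃ s ∈ Ioc (0 : ℝ) 1, ∃ x ∈ A, z = s • x}

lemma volume_eq_euclideanHausdorffMeasure (n : ℕ) : (volume : Measure (E n)) = μHE[n] :=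
  (EuclideanSpace.euclideanHausdorffMeasure_eq_volume n).symm

lemma measurableSet_cone_of_flat {n : ℕ} {D : Set (E n)} (hD : MeasurableSet D) {u : E n} {h : ℝ}
    (hh : 0 < h) (hDu : ∀ z ∈ D, inner ℝ u z = h) : MeasurableSet (cone D) := by
  have : cone D = {z | inner ℝ u z ∈ Ioc 0 h} ∩ (fun z => (h / inner ℝ u z) • z) ⁻¹' D := by
    ext z
    constructor
    · rintro ⟨s, hs, x, hx, rfl⟩
      have h1 : inner ℝ u (s • x) = s * h := by rw [inner_smul_right, hDu x hx]
      refine ⟨?_, ?_⟩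
      · rw [mem_ofPred_eq, h1]
        exact ⟨mul_pos hs.1 hh, by nlinarith [hs.2]⟩
      · rw [mem_preimage, h1, smul_smul]
        have : h / (s * h) * s = 1 := by
          have := hs.1.ne'
          field_simp
        rwa [this, one_smul]
    · rintro ⟨h1, h2⟩
      refine ⟨inner ℝ u z / h, ⟨div_pos h1.1 hh, (div_le_one hh).2 h1.2⟩, _, h2, ?_⟩
      rw [smul_smul]
      have : inner ℝ u z / h * (h / inner ℝ u z) = 1 := by
        have := h1.1.ne'
        field_simp
      rw [this, one_smul]
  rw [this]
  refine MeasurableSet.inter ?_ ?_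
  · exact (by fun_prop : Measurable fun z : E n => inner ℝ u z) measurableSet_Ioc
  · have : Measurable fun z : E n => (h / inner ℝ u z) • z := by fun_prop
    exact this hD

/-- Slice by hyperplanes orthogonal to `u`: the slice at height `x ∈ (0, h]` is `(x/h) • D`, of area
`(x/h)^(n-1)` times that of `D`, and these factors integrate to `h/n`. -/
lemma volume_cone_of_flat {n : ℕ} (hn : 1 ≤ n) {D : Set (E n)} (hD : MeasurableSet D) {u : E n}
    (hu : ‖u‖ = 1) {h : ℝ} (hh : 0 < h) (hDu : ∀ z ∈ D, inner ℝ u z = h) :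
    n * volume (cone D) = ENNReal.ofReal h * surfaceMeasure n D := by
  have hu0 : u ≠ 0 := by rintro rfl; simp at hu
  have hfr : Module.finrank ℝ (E n) = n := by simp
  have key := EuclideanGeometry.euclideanHausdorffMeasure_eq_lintegral (0 : E n) hu0
    (measurableSet_cone_of_flat hD hh hDu)
  rw [hfr] at key
  have hue : ‖u‖ₑ = 1 := by rw [← ofReal_norm, hu, ENNReal.ofReal_one]
  rw [volume_eq_euclideanHausdorffMeasure, key, hue, one_mul]
  have hslice : ∀ x : ℝ, (μHE[n - 1] : Measure (E n))
      (cone D ∩ AffineSubspace.mk' (x • u +ᵥ (0 : E n)) (ℝ ∙ u)ᗮ)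
      = (Ioc 0 h).indicator (fun x => ENNReal.ofReal ((x / h) ^ (n - 1))) x *
        surfaceMeasure n D := by
    intro x
    have hmem : ∀ z : E n, z ∈ AffineSubspace.mk' (x • u +ᵥ (0 : E n)) (ℝ ∙ u)ᗮ ↔
        inner ℝ u z = x := by
      intro z
      rw [AffineSubspace.mem_mk', Submodule.mem_orthogonal_singleton_iff_inner_right]
      simp [inner_sub_right, inner_smul_right, hu, sub_eq_zero]
    by_cases hx : x ∈ Ioc 0 h
    · have hxh : 0 < x / h := div_pos hx.1 hh
      have : cone D ∩ AffineSubspace.mk' (x • u +ᵥ (0 : E n)) (ℝ ∙ u)ᗮ = (x / h) • D := by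
        ext z
        rw [mem_inter_iff, SetLike.mem_coe, hmem, mem_smul_set]
        constructor
        · rintro ⟨⟨s, hs, y, hy, rfl⟩, h1⟩
          rw [inner_smul_right, hDu y hy] at h1
          exact ⟨y, hy, by rw [← h1, mul_div_cancel_right₀ _ hh.ne']⟩
        · rintro ⟨y, hy, rfl⟩
          refine ⟨⟨x / h, ⟨hxh, (div_le_one hh).2 hx.2⟩, y, hy, rfl⟩, ?_⟩
          rw [inner_smul_right, hDu y hy, div_mul_cancel₀ _ hh.ne']
      rw [this, Measure.euclideanHausdorffMeasure_smul₀ _ hxh.ne', indicator_of_mem hx,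
        surfaceMeasure, ENNReal.smul_def, smul_eq_mul, ENNReal.ofReal_pow hxh.le, ENNReal.coe_pow]
      congr 2
      exact Real.enorm_of_nonneg hxh.le
    · have : cone D ∩ AffineSubspace.mk' (x • u +ᵥ (0 : E n)) (ℝ ∙ u)ᗮ = ∅ := by
        refine eq_empty_of_forall_notMem ?_
        rintro _ ⟨⟨s, hs, y, hy, rfl⟩, h1⟩
        rw [SetLike.mem_coe, hmem, inner_smul_right, hDu y hy] at h1
        exact hx (h1 ▸ ⟨mul_pos hs.1 hh, by nlinarith [hs.2]⟩)
      rw [this, indicator_of_notMem hx]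
      simp
  simp_rw [hslice]
  rw [lintegral_mul_const, lintegral_indicator measurableSet_Ioc,
    ← ofReal_integral_eq_lintegral_ofReal, ← intervalIntegral.integral_of_le hh.le, ← mul_assoc]
  · congr 1
    have : ∫ x in (0 : ℝ)..h, (x / h) ^ (n - 1) = h / n := by
      rw [intervalIntegral.integral_comp_div (fun x => x ^ (n - 1)) hh.ne', zero_div,
        div_self hh.ne', integral_pow, Nat.sub_add_cancel hn, Nat.cast_sub hn, Nat.cast_one,
        sub_add_cancel, one_pow, zero_pow (by omega), sub_zero, smul_eq_mul, mul_one_div]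
    rw [this, ← ENNReal.ofReal_natCast, ← ENNReal.ofReal_mul (by positivity)]
    congr 1
    have : (n : ℝ) ≠ 0 := by positivity
    field_simp
  · exact (Continuous.integrableOn_Icc (by fun_prop)).mono_set Ioc_subset_Icc_self
  · filter_upwards [ae_restrict_mem measurableSet_Ioc] with x hx
    have := hx.1
    positivity
  · exact Measurable.indicator (by fun_prop) measurableSet_Ioc

end Cone

/-! ### Outer normals of convex bodies. -/

section Normals

variable {n : ℕ} {K : Set (E n)}

lemma exists_isOuterUnitNormal (hc : Convex ℝ K) (h0 : K ∈ 𝓝 0) {x : E n}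
    (hx : x ∈ frontier K) : ∃ u, IsOuterUnitNormal K x u := by
  have hne : (interior K).Nonempty := ⟨0, mem_interior_iff_mem_nhds.2 h0⟩
  obtain ⟨f, hf⟩ := geometric_hahn_banach_open_point hc.interior isOpen_interior hx.2
  set v := (InnerProductSpace.toDual ℝ (E n)).symm f with hv
  have hfv : ∀ z, f z = inner ℝ v z := fun z => by
    rw [hv, InnerProductSpace.toDual_symm_apply]
  have hv0 : v ≠ 0 := by
    rintro h
    obtain ⟨a, ha⟩ := hne
    have := hf a ha
    rw [hfv, hfv, h, inner_zero_left, inner_zero_left] at this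
    exact lt_irrefl _ this
  refine ⟨‖v‖⁻¹ • v, norm_smul_inv_norm hv0, fun z hz => ?_⟩
  have hz' : z ∈ closure (interior K) := by
    rw [hc.closure_interior_eq_closure_of_nonempty_interior hne]
    exact subset_closure hz
  have : inner ℝ v z ≤ inner ℝ v x :=
    closure_minimal (t := {z | inner ℝ v z ≤ inner ℝ v x})
      (fun a ha => by have := hf a ha; rw [hfv, hfv] at this; exact this.le)
      (isClosed_le (by fun_prop) (by fun_prop)) hz'
  rw [inner_smul_left, inner_sub_right]
  exact mul_nonpos_of_nonneg_of_nonpos (by simp) (by linarith)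

lemma IsOuterUnitNormal.le_inner {x u : E n} (hu : IsOuterUnitNormal K x u) {ρ : ℝ} (hρ : 0 ≤ ρ)
    (hb : closedBall 0 ρ ⊆ K) : ρ ≤ inner ℝ u x := by
  have hmem : ρ • u ∈ K := hb (by simp [norm_smul, hu.1, abs_of_nonneg hρ])
  have := hu.2 _ hmem
  rw [inner_sub_right, inner_smul_right, real_inner_self_eq_norm_sq, hu.1] at this
  linarith

lemma IsOuterUnitNormal.notMem_interior {x u : E n} (hu : IsOuterUnitNormal K x u) :
    x ∉ interior K := by
  intro hx
  have ht : Tendsto (fun s : ℝ => x + s • u) (𝓝[>] 0) (𝓝 x) := by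
    have : Continuous fun s : ℝ => x + s • u := by fun_prop
    have := this.tendsto 0
    simp only [zero_smul, add_zero] at this
    exact this.mono_left nhdsWithin_le_nhds
  obtain ⟨s, hs, hs0⟩ := ((ht.eventually (mem_interior_iff_mem_nhds.1 hx)).and
    eventually_mem_nhdsWithin).exists
  have := hu.2 _ hs
  rw [add_sub_cancel_left, inner_smul_right, real_inner_self_eq_norm_sq, hu.1] at this
  have : 0 < s := hs0
  linarith

lemma IsOuterUnitNormal.mem_frontier {x u : E n} (hx : x ∈ K) (hu : IsOuterUnitNormal K x u) :
    x ∈ frontier K := ⟨subset_closure hx, hu.notMem_interior⟩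

lemma outerNormal_eq {x u : E n} (hu : IsOuterUnitNormal K x u)
    (h : ∀ u', IsOuterUnitNormal K x u' → u' = u) : outerNormal K x = u := by
  have hex : ∃! u, IsOuterUnitNormal K x u := ⟨u, hu, h⟩
  rw [outerNormal, dif_pos hex]
  exact h _ hex.choose_spec.1

/-- The pairs (point, unit normal) with normal at distance at least `η` from `u₀` form a compact
set. Its projection to `K` is closed and misses `x₀`. -/
lemma eventually_normal_close (hK : IsCompact K) {x₀ u₀ : E n}
    (h : ∀ u', IsOuterUnitNormal K x₀ u' → u' = u₀) {η : ℝ} (hη : 0 < η) :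
    ∃ U ∈ 𝓝 x₀, ∀ x ∈ U, x ∈ K → ∀ u, IsOuterUnitNormal K x u → ‖u - u₀‖ ≤ η := by
  set C : Set (E n × E n) := (K ×ˢ sphere 0 1) ∩
    ({q | ∀ z ∈ K, inner ℝ q.2 (z - q.1) ≤ 0} ∩ {q | η ≤ ‖q.2 - u₀‖}) with hC
  have hCc : IsCompact C := by
    refine (hK.prod (isCompact_sphere _ _)).inter_right (IsClosed.inter ?_ ?_)
    · simp only [ofPred_forall]
      exact isClosed_biInter fun z _ => isClosed_le (by fun_prop) (by fun_prop)
    · exact isClosed_le (by fun_prop) (by fun_prop)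
  refine ⟨(Prod.fst '' C)ᶜ, (hCc.image continuous_fst).isClosed.isOpen_compl.mem_nhds ?_, ?_⟩
  · rintro ⟨⟨x, u⟩, ⟨⟨_, hu⟩, hn, hη'⟩, rfl⟩
    have := h u ⟨by simpa using hu, hn⟩
    simp only [mem_ofPred_eq, this, sub_self, norm_zero] at hη'
    linarith
  · intro x hx hxK u hu
    by_contra hcon
    exact hx ⟨(x, u), ⟨⟨hxK, by simp [hu.1]⟩, hu.2, (not_le.1 hcon).le⟩, rfl⟩

end Normals

/-! ### The cone measure on the boundary. -/

section ConeMeasure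

variable {n : ℕ} {K : Set (E n)}

lemma gauge_eq_of_frontier (hc : Convex ℝ K) (h0 : K ∈ 𝓝 0) {x : E n} (hx : x ∈ frontier K)
    {s : ℝ} (hs : 0 ≤ s) : gauge K (s • x) = s := by
  rw [gauge_smul_of_nonneg hs, (gauge_eq_one_iff_mem_frontier hc h0).2 hx, smul_eq_mul, mul_one]

/-- The cone measure of `K` (not normalised), as a measure on the boundary. -/
noncomputable def coneMeasure (K : Set (E n)) : Measure (E n) :=
  (volume.restrict (K \ {0})).map fun z => (gauge K z)⁻¹ • z

lemma measurable_radial (hc : Convex ℝ K) (h0 : K ∈ 𝓝 0) :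
    Measurable fun z : E n => (gauge K z)⁻¹ • z :=
  (continuous_gauge hc h0).measurable.inv.smul measurable_id

lemma coneMeasure_apply (hc : Convex ℝ K) (h0 : K ∈ 𝓝 0) {A : Set (E n)} (hA : MeasurableSet A)
    (hAK : A ⊆ frontier K) (hcl : IsClosed K) : coneMeasure K A = volume (cone A) := by
  rw [coneMeasure, Measure.map_apply (measurable_radial hc h0) hA,
    Measure.restrict_apply (measurable_radial hc h0 hA)]
  congr 1
  ext z
  constructor
  · rintro ⟨hz, hzK, -⟩
    rw [mem_preimage] at hz
    have h1 := (gauge_eq_one_iff_mem_frontier hc h0).2 (hAK hz)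
    have hg : gauge K z ≠ 0 := by
      intro h
      simp [h, gauge_zero] at h1
    exact ⟨gauge K z, ⟨lt_of_le_of_ne (gauge_nonneg z) hg.symm, gauge_le_one_of_mem hzK⟩, _, hz,
      by rw [smul_smul, mul_inv_cancel₀ hg, one_smul]⟩
  · rintro ⟨s, hs, x, hx, rfl⟩
    have hg := gauge_eq_of_frontier hc h0 (hAK hx) hs.1.le
    refine ⟨?_, ?_, ?_⟩
    · rw [mem_preimage, hg, smul_smul, inv_mul_cancel₀ hs.1.ne', one_smul]
      exact hx
    · have h0K : (0 : E n) ∈ K := mem_of_mem_nhds h0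
      have hxK : x ∈ K := hcl.frontier_subset (hAK hx)
      have := hc h0K hxK (sub_nonneg.2 hs.2) hs.1.le (by ring)
      simpa using this
    · intro h
      rw [mem_singleton_iff] at h
      rw [h, gauge_zero] at hg
      exact hs.1.ne hg

lemma coneMeasure_frontier (hn : 1 ≤ n) (hc : Convex ℝ K) (hK : IsCompact K) (h0 : K ∈ 𝓝 0) :
    coneMeasure K (frontier K) = volume K := by
  have : Nonempty (Fin n) := ⟨⟨0, hn⟩⟩
  have : Nontrivial (E n) := inferInstance
  rw [coneMeasure, Measure.map_apply (measurable_radial hc h0) isClosed_frontier.measurableSet,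
    Measure.restrict_apply (measurable_radial hc h0 isClosed_frontier.measurableSet),
    inter_eq_right.2, measure_sdiff_null (measure_singleton 0)]
  rintro z ⟨hzK, hz0⟩
  have hg : 0 < gauge K z := (gauge_pos (absorbent_nhds_zero h0)
    (NormedSpace.isVonNBounded_of_isBounded ℝ hK.isBounded)).2 hz0
  rw [mem_preimage, ← gauge_eq_one_iff_mem_frontier hc h0,
    gauge_smul_of_nonneg (inv_nonneg.2 hg.le), smul_eq_mul, inv_mul_cancel₀ hg.ne']

end ConeMeasure

/-! ### The cone volume formula. -/

section ConeFormula

open scoped NNReal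

variable {n : ℕ} {K : Set (E n)}

/-- Projection along `u` onto the hyperplane at height `h`. -/
noncomputable def flatten (u : E n) (h : ℝ) (x : E n) : E n := x - (inner ℝ u x - h) • u

lemma inner_flatten {u : E n} (hu : ‖u‖ = 1) (h : ℝ) (x : E n) : inner ℝ u (flatten u h x) = h := by
  simp [flatten, inner_sub_right, inner_smul_right, hu]

lemma continuous_flatten (u : E n) (h : ℝ) : Continuous (flatten u h) := by
  unfold flatten; fun_prop

/-- A map that differs from the identity by a small Lipschitz multiple of a unit vector. -/
lemma dist_bounds_of_perturbation {u : E n} (hu : ‖u‖ = 1) {φ : E n → ℝ} {s : Set (E n)} {κ : ℝ}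
    {L : ℝ≥0} (hκ : κ = 1 - (L : ℝ)⁻¹) (hL : 1 < L)
    (hφ : ∀ x ∈ s, ∀ y ∈ s, |φ x - φ y| ≤ κ * ‖x - y‖) :
    LipschitzOnWith L (fun x => x - φ x • u) s ∧
      ∀ x ∈ s, ∀ y ∈ s, dist x y ≤ L * dist (x - φ x • u) (y - φ y • u) := by
  have hL' : (1 : ℝ) < L := by exact_mod_cast hL
  have hLi : (L : ℝ)⁻¹ * L = 1 := inv_mul_cancel₀ (by positivity)
  have heq : ∀ x y, (x - φ x • u) - (y - φ y • u) = (x - y) - (φ x - φ y) • u := fun x y => by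
    module
  have hnorm : ∀ x y, ‖(φ x - φ y) • u‖ = |φ x - φ y| := fun x y => by
    rw [norm_smul, hu, mul_one, Real.norm_eq_abs]
  constructor
  · refine LipschitzOnWith.of_dist_le_mul fun x hx y hy => ?_
    rw [dist_eq_norm, dist_eq_norm, heq]
    have h1 := norm_sub_le (x - y) ((φ x - φ y) • u)
    rw [hnorm] at h1
    have h2 := hφ x hx y hy
    have h3 : 1 + κ ≤ L := by
      rw [hκ]
      nlinarith [sq_nonneg ((L : ℝ) - 1), inv_nonneg.2 L.coe_nonneg, sq_nonneg ((L : ℝ)⁻¹ - 1)]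
    nlinarith [norm_nonneg (x - y)]
  · intro x hx y hy
    rw [dist_eq_norm, dist_eq_norm, heq]
    have h1 := norm_sub_norm_le (x - y) ((φ x - φ y) • u)
    rw [hnorm] at h1
    have h2 := hφ x hx y hy
    have h3 : (L : ℝ)⁻¹ * ‖x - y‖ ≤ ‖x - y - (φ x - φ y) • u‖ := by
      rw [hκ] at h2
      linarith
    calc ‖x - y‖ = L * ((L : ℝ)⁻¹ * ‖x - y‖) := by rw [← mul_assoc, mul_comm (L : ℝ), hLi, one_mul]
      _ ≤ _ := by gcongr

/-- Near a smooth point all normals are close to `u₀`, so projecting along `u₀` to the tangent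
hyperplane is almost isometric on the patch, and so is its homogeneous extension to the cone. The
flat case then applies, with losses `L ^ n` (volume), `L ^ (n - 1)` (area) and `L` (integrand),
together `L ^ (2 * n)`. -/
lemma local_cone_bounds (hn : 1 ≤ n) (hc : Convex ℝ K) (hK : IsCompact K) (h0 : K ∈ 𝓝 0)
    {x₀ u₀ : E n} (hu₀ : IsOuterUnitNormal K x₀ u₀)
    (huniq : ∀ u', IsOuterUnitNormal K x₀ u' → u' = u₀) {L : ℝ≥0} (hL : 1 < L) :
    ∃ U ∈ 𝓝 x₀, ∀ A, MeasurableSet A → A ⊆ U ∩ frontier K →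
      (∀ x ∈ A, ∃! u, IsOuterUnitNormal K x u) →
      n * volume (cone A) ≤ (L : ℝ≥0∞) ^ (2 * n) *
        ∫⁻ x in A, ENNReal.ofReal (inner ℝ x (outerNormal K x)) ∂(surfaceMeasure n) ∧
      ∫⁻ x in A, ENNReal.ofReal (inner ℝ x (outerNormal K x)) ∂(surfaceMeasure n) ≤
        (L : ℝ≥0∞) ^ (2 * n) * (n * volume (cone A)) := by
  have hL' : (1 : ℝ) < L := by exact_mod_cast hL
  obtain ⟨ρ', hρ', hball⟩ := Metric.mem_nhds_iff.1 h0
  set ρ := ρ' / 2 with hρdef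
  have hρ : 0 < ρ := by positivity
  have hballc : closedBall 0 ρ ⊆ K := (closedBall_subset_ball (by linarith)).trans hball
  obtain ⟨R, hR, hKR⟩ : ∃ R, 0 < R ∧ ∀ x ∈ K, ‖x‖ ≤ R := by
    obtain ⟨R, hR, h⟩ := hK.isBounded.exists_pos_norm_le
    exact ⟨R, hR, h⟩
  have hfK : frontier K ⊆ K := hK.isClosed.frontier_subset
  set h := inner ℝ u₀ x₀ with hh
  have hρh : ρ ≤ h := hu₀.le_inner hρ.le hballc
  have hhpos : 0 < h := hρ.trans_le hρh
  -- `C * η` bounds the Lipschitz constant of the displacement `φ` on the cone; because `ρ ≤ h`, the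
  -- choice `C * η = κ` also bounds the oscillation `(1 + R) * η` of the integrand by `κ * h`.
  set C := 1 + (1 + R) / ρ with hC
  have hCpos : 1 ≤ C := by
    have : 0 ≤ (1 + R) / ρ := by positivity
    linarith
  set κ := 1 - (L : ℝ)⁻¹ with hκ
  have hκpos : 0 < κ := sub_pos.2 (inv_lt_one_of_one_lt₀ hL')
  set η := κ / C with hη
  have hηpos : 0 < η := by positivity
  have hCη : C * η = κ := mul_div_cancel₀ _ (by positivity)
  have hηκ : η ≤ κ := by nlinarith
  obtain ⟨U, hU, hUn⟩ := eventually_normal_close hK huniq hηpos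
  refine ⟨U ∩ closedBall x₀ η, inter_mem hU (closedBall_mem_nhds _ hηpos), ?_⟩
  intro A hA hAU hAN
  have hAK : A ⊆ frontier K := fun x hx => (hAU hx).2
  have hAd : ∀ x ∈ A, ‖x - x₀‖ ≤ η := fun x hx => by
    simpa [dist_eq_norm] using (hAU hx).1.2
  have hAn : ∀ x ∈ A, ∀ u, IsOuterUnitNormal K x u → ‖u - u₀‖ ≤ η := fun x hx =>
    hUn x (hAU hx).1.1 (hfK (hAK hx))
  -- the boundary is almost flat near `x₀`
  have hflat1 : ∀ x ∈ A, ∀ y ∈ A, inner ℝ u₀ (y - x) ≤ η * ‖x - y‖ := by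
    intro x hx y hy
    obtain ⟨u, hu⟩ := exists_isOuterUnitNormal hc h0 (hAK hx)
    have h1 := hu.2 y (hfK (hAK hy))
    have h2 : inner ℝ (u₀ - u) (y - x) ≤ ‖u₀ - u‖ * ‖y - x‖ := real_inner_le_norm _ _
    rw [inner_sub_left, norm_sub_rev u₀, norm_sub_rev y] at h2
    have h3 := hAn x hx u hu
    nlinarith [norm_nonneg (x - y)]
  have hflat : ∀ x ∈ A, ∀ y ∈ A, |inner ℝ u₀ x - inner ℝ u₀ y| ≤ η * ‖x - y‖ := by
    intro x hx y hy
    rw [← inner_sub_right, abs_le]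
    have h1 := hflat1 x hx y hy
    have h2 := hflat1 y hy x hx
    rw [norm_sub_rev y] at h2
    rw [← neg_sub x y, inner_neg_right] at h1
    exact ⟨by linarith, h2⟩
  have hheight : ∀ x ∈ A, |inner ℝ u₀ x - h| ≤ η := fun x hx => by
    rw [hh, ← inner_sub_right]
    refine (abs_real_inner_le_norm _ _).trans ?_
    rw [hu₀.1, one_mul]
    exact hAd x hx
  -- comparison of surface areas
  set D := flatten u₀ h '' A with hD
  have hpert := dist_bounds_of_perturbation (s := A) (φ := fun x => inner ℝ u₀ x - h) hu₀.1 hκ hL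
    (fun x hx y hy => by
      rw [sub_sub_sub_cancel_right]
      exact (hflat x hx y hy).trans (by gcongr))
  have hσ1 : surfaceMeasure n D ≤ (L : ℝ≥0∞) ^ (n - 1) * surfaceMeasure n A :=
    euclideanHausdorffMeasure_image_le hpert.1 _
  have hσ2 : surfaceMeasure n A ≤ (L : ℝ≥0∞) ^ (n - 1) * surfaceMeasure n D :=
    euclideanHausdorffMeasure_le_image hpert.2 _
  have hDm : MeasurableSet D := by
    refine hA.image_of_continuousOn_injOn (continuous_flatten u₀ h).continuousOn ?_
    intro x hx y hy hxy
    have := hpert.2 x hx y hy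
    change dist x y ≤ L * dist (flatten u₀ h x) (flatten u₀ h y) at this
    rw [hxy, dist_self, mul_zero] at this
    exact dist_le_zero.1 this
  have hDu : ∀ z ∈ D, inner ℝ u₀ z = h := by
    rintro _ ⟨x, -, rfl⟩
    exact inner_flatten hu₀.1 h x
  have hcone := volume_cone_of_flat hn hDm hu₀.1 hhpos hDu
  -- comparison of the volumes of the cones
  set φ : E n → ℝ := fun z => inner ℝ u₀ z - h * gauge K z with hφ
  have hφs : ∀ s : ℝ, 0 ≤ s → ∀ x ∈ A, φ (s • x) = s * (inner ℝ u₀ x - h) := by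
    intro s hs x hx
    rw [hφ]
    simp only
    rw [gauge_eq_of_frontier hc h0 (hAK hx) hs, inner_smul_right]
    ring
  -- The gauge makes `φ` positively homogeneous along the rays through `A`, so this map extends the
  -- flattening of `A` to the cone.
  have hTimg : (fun z => z - φ z • u₀) '' cone A = cone D := by
    ext z
    constructor
    · rintro ⟨_, ⟨s, hs, x, hx, rfl⟩, rfl⟩
      refine ⟨s, hs, flatten u₀ h x, ⟨x, hx, rfl⟩, ?_⟩
      simp only [hφs s hs.1.le x hx, flatten]
      module
    · rintro ⟨s, hs, _, ⟨x, hx, rfl⟩, rfl⟩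
      refine ⟨s • x, ⟨s, hs, x, hx, rfl⟩, ?_⟩
      simp only [hφs s hs.1.le x hx, flatten]
      module
  have hgl : ∀ z z', |gauge K z - gauge K z'| ≤ ‖z - z'‖ / ρ := by
    intro z z'
    have := (hc.lipschitzWith_gauge (r := ⟨ρ, hρ.le⟩) hρ
      (ball_subset_closedBall.trans hballc)).dist_le_mul z z'
    rw [Real.dist_eq, dist_eq_norm] at this
    rw [div_eq_inv_mul]
    exact this
  have hφl : ∀ z ∈ cone A, ∀ z' ∈ cone A, |φ z - φ z'| ≤ κ * ‖z - z'‖ := by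
    rintro _ ⟨s, hs, x, hx, rfl⟩ _ ⟨r, hr, y, hy, rfl⟩
    rw [hφs s hs.1.le x hx, hφs r hr.1.le y hy]
    have hsr := hgl (s • x) (r • y)
    rw [gauge_eq_of_frontier hc h0 (hAK hx) hs.1.le,
      gauge_eq_of_frontier hc h0 (hAK hy) hr.1.le] at hsr
    set δ := ‖s • x - r • y‖ with hδ
    have h1 : r * ‖x - y‖ ≤ δ + |s - r| * R := by
      have h2 : r • (x - y) = (s • x - r • y) - (s - r) • x := by module
      calc r * ‖x - y‖ = ‖r • (x - y)‖ := by rw [norm_smul, Real.norm_of_nonneg hr.1.le]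
        _ ≤ ‖s • x - r • y‖ + ‖(s - r) • x‖ := by rw [h2]; exact norm_sub_le _ _
        _ ≤ δ + |s - r| * R := by
          rw [norm_smul, Real.norm_eq_abs]
          gcongr
          exact hKR x (hfK (hAK hx))
    have h3 : s * (inner ℝ u₀ x - h) - r * (inner ℝ u₀ y - h)
        = (s - r) * (inner ℝ u₀ x - h) + r * (inner ℝ u₀ x - inner ℝ u₀ y) := by ring
    calc |s * (inner ℝ u₀ x - h) - r * (inner ℝ u₀ y - h)|
        ≤ |s - r| * |inner ℝ u₀ x - h| + r * |inner ℝ u₀ x - inner ℝ u₀ y| := by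
          rw [h3]
          refine (abs_add_le _ _).trans ?_
          rw [abs_mul, abs_mul, abs_of_nonneg hr.1.le]
      _ ≤ |s - r| * η + r * (η * ‖x - y‖) := by
          gcongr
          · exact hheight x hx
          · exact hr.1.le
          · exact hflat x hx y hy
      _ ≤ |s - r| * η + η * (δ + |s - r| * R) := by nlinarith
      _ = η * δ + η * (1 + R) * |s - r| := by ring
      _ ≤ η * δ + η * (1 + R) * (δ / ρ) := by gcongr
      _ = C * η * δ := by rw [hC]; ring
      _ = κ * δ := by rw [hCη]
  have hTpert := dist_bounds_of_perturbation hu₀.1 hκ hL hφl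
  have hv1 : volume (cone D) ≤ (L : ℝ≥0∞) ^ n * volume (cone A) := by
    rw [volume_eq_euclideanHausdorffMeasure, ← hTimg]
    exact euclideanHausdorffMeasure_image_le hTpert.1 _
  have hv2 : volume (cone A) ≤ (L : ℝ≥0∞) ^ n * volume (cone D) := by
    rw [volume_eq_euclideanHausdorffMeasure, ← hTimg]
    exact euclideanHausdorffMeasure_le_image hTpert.2 _
  -- the integrand is almost constant
  have hf : ∀ x ∈ A, |inner ℝ x (outerNormal K x) - h| ≤ (1 + R) * η := by
    intro x hx
    have hu : IsOuterUnitNormal K x (outerNormal K x) := by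
      have hex := hAN x hx
      rw [outerNormal, dif_pos hex]
      exact hex.choose_spec.1
    set u := outerNormal K x with hudef
    have h1 : inner ℝ x u - h = inner ℝ x (u - u₀) + (inner ℝ u₀ x - h) := by
      rw [inner_sub_right, real_inner_comm x u₀]; ring
    rw [h1]
    calc _ ≤ |inner ℝ x (u - u₀)| + |inner ℝ u₀ x - h| := abs_add_le _ _
      _ ≤ R * η + η := by
        gcongr
        · refine (abs_real_inner_le_norm _ _).trans ?_
          gcongr
          · exact hKR x (hfK (hAK hx))
          · exact hAn x hx u hu
        · exact hheight x hx
      _ = (1 + R) * η := by ring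
  have hκh : (1 + R) * η ≤ κ * h := by
    rw [← hCη]
    have : (1 + R) ≤ C * h := by
      have : (1 + R) = (1 + R) / ρ * ρ := by field_simp
      rw [this]
      have : 0 ≤ (1 + R) / ρ := by positivity
      gcongr
      linarith
    nlinarith
  have hLi : (L : ℝ)⁻¹ * L = 1 := inv_mul_cancel₀ (by positivity)
  have hI1 : ENNReal.ofReal h * surfaceMeasure n A ≤
      L * ∫⁻ x in A, ENNReal.ofReal (inner ℝ x (outerNormal K x)) ∂(surfaceMeasure n) := by
    have hLh : ENNReal.ofReal h = L * ENNReal.ofReal ((L : ℝ)⁻¹ * h) := by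
      rw [← ENNReal.ofReal_coe_nnreal, ← ENNReal.ofReal_mul L.coe_nonneg, ← mul_assoc, mul_comm (L : ℝ), hLi,
        one_mul]
    rw [hLh, mul_assoc]
    gcongr
    rw [← setLIntegral_const]
    refine setLIntegral_mono' hA fun x hx => ENNReal.ofReal_le_ofReal ?_
    have := (abs_le.1 (hf x hx)).1
    have : κ * h = h - (L : ℝ)⁻¹ * h := by rw [hκ]; ring
    linarith
  have hI2 : ∫⁻ x in A, ENNReal.ofReal (inner ℝ x (outerNormal K x)) ∂(surfaceMeasure n) ≤
      L * (ENNReal.ofReal h * surfaceMeasure n A) := by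
    rw [← ENNReal.ofReal_coe_nnreal, ← mul_assoc, ← ENNReal.ofReal_mul L.coe_nonneg, ← setLIntegral_const]
    refine setLIntegral_mono' hA fun x hx => ENNReal.ofReal_le_ofReal ?_
    have h1 := (abs_le.1 (hf x hx)).2
    have h3 : 1 + κ ≤ L := by
      rw [hκ]
      nlinarith [sq_nonneg ((L : ℝ) - 1), inv_nonneg.2 L.coe_nonneg, sq_nonneg ((L : ℝ)⁻¹ - 1)]
    nlinarith
  have hpow : (L : ℝ≥0∞) ^ (2 * n) = L ^ n * L ^ (n - 1) * L := by
    rw [mul_assoc, ← pow_succ, Nat.sub_add_cancel hn, ← pow_add, two_mul]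
  constructor
  · calc n * volume (cone A) ≤ n * ((L : ℝ≥0∞) ^ n * volume (cone D)) := by gcongr
      _ = (L : ℝ≥0∞) ^ n * (ENNReal.ofReal h * surfaceMeasure n D) := by rw [← hcone]; ring
      _ ≤ (L : ℝ≥0∞) ^ n * (ENNReal.ofReal h * (L ^ (n - 1) * surfaceMeasure n A)) := by gcongr
      _ = (L : ℝ≥0∞) ^ n * L ^ (n - 1) * (ENNReal.ofReal h * surfaceMeasure n A) := by ring
      _ ≤ _ := by rw [hpow, mul_assoc _ (L : ℝ≥0∞)]; gcongr
  · calc _ ≤ L * (ENNReal.ofReal h * surfaceMeasure n A) := hI2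
      _ ≤ L * (ENNReal.ofReal h * (L ^ (n - 1) * surfaceMeasure n D)) := by gcongr
      _ = L * L ^ (n - 1) * (n * volume (cone D)) := by rw [hcone]; ring
      _ ≤ L * L ^ (n - 1) * (n * (L ^ n * volume (cone A))) := by gcongr
      _ = _ := by rw [hpow]; ring

/-- **Cone volume formula**: on a set of smooth boundary points. -/
theorem setLIntegral_inner_outerNormal (hn : 1 ≤ n) (hc : Convex ℝ K) (hK : IsCompact K)
    (h0 : K ∈ 𝓝 0) {s : Set (E n)} (hs : MeasurableSet s) (hsK : s ⊆ frontier K)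
    (hsN : ∀ x ∈ s, ∃! u, IsOuterUnitNormal K x u) :
    ∫⁻ x in s, ENNReal.ofReal (inner ℝ x (outerNormal K x)) ∂(surfaceMeasure n) =
      n * coneMeasure K s := by
  set ν := (surfaceMeasure n).withDensity
    fun x => ENNReal.ofReal (inner ℝ x (outerNormal K x)) with hν
  have hloc : ∀ c : ℝ, 1 < c → ∀ x ∈ s, ∃ U ∈ 𝓝 x, ∀ A, MeasurableSet A → A ⊆ U ∩ s →
      ((n : ℝ≥0∞) • coneMeasure K) A ≤ (ENNReal.ofReal c • ν) A ∧
      ν A ≤ (ENNReal.ofReal c • ((n : ℝ≥0∞) • coneMeasure K)) A := by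
    intro c hc1 x hx
    obtain ⟨u, hu, huniq⟩ := hsN x hx
    -- The `2n`-th root of `c`, so that the loss in `local_cone_bounds` is exactly `c`.
    set L : ℝ≥0 := ⟨c ^ (1 / ((2 * n : ℕ) : ℝ)), by positivity⟩ with hL
    have hn2 : (0 : ℝ) < ((2 * n : ℕ) : ℝ) := by exact_mod_cast (by omega : 0 < 2 * n)
    have hL1 : 1 < L := by
      have : (1 : ℝ) < c ^ (1 / ((2 * n : ℕ) : ℝ)) := Real.one_lt_rpow hc1 (by positivity)
      exact_mod_cast this
    have hLp : (L : ℝ≥0∞) ^ (2 * n) = ENNReal.ofReal c := by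
      rw [← ENNReal.ofReal_coe_nnreal, ← ENNReal.ofReal_pow L.coe_nonneg]
      congr 1
      change (c ^ (1 / ((2 * n : ℕ) : ℝ))) ^ (2 * n) = c
      rw [← Real.rpow_natCast, ← Real.rpow_mul (by linarith), one_div_mul_cancel hn2.ne',
        Real.rpow_one]
    obtain ⟨U, hU, h⟩ := local_cone_bounds hn hc hK h0 hu huniq hL1
    refine ⟨U, hU, fun A hA hAU => ?_⟩
    have hAK : A ⊆ frontier K := fun y hy => hsK (hAU hy).2
    have := h A hA (fun y hy => ⟨(hAU hy).1, hAK hy⟩) (fun y hy => hsN y (hAU hy).2)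
    rw [hLp, ← withDensity_apply _ hA, ← coneMeasure_apply hc h0 hA hAK hK.isClosed] at this
    simpa only [Measure.smul_apply, smul_eq_mul] using this
  rw [← withDensity_apply _ hs]
  refine le_antisymm (ENNReal_le_of_forall_one_lt_mul fun c hc1 => ?_)
    (ENNReal_le_of_forall_one_lt_mul fun c hc1 => ?_)
  · have := measure_le_of_locally_le (μ := ν) (ν := ENNReal.ofReal c • ((n : ℝ≥0∞) • coneMeasure K))
      hs fun x hx => (hloc c hc1 x hx).imp fun U hU => ⟨hU.1, fun A hA hAU => (hU.2 A hA hAU).2⟩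
    simpa only [Measure.smul_apply, smul_eq_mul] using this
  · have := measure_le_of_locally_le (μ := (n : ℝ≥0∞) • coneMeasure K) (ν := ENNReal.ofReal c • ν)
      hs fun x hx => (hloc c hc1 x hx).imp fun U hU => ⟨hU.1, fun A hA hAU => (hU.2 A hA hAU).1⟩
    simpa only [Measure.smul_apply, smul_eq_mul] using this

end ConeFormula

/-! ### Support function and faces of a polytope. -/

section Polytope

variable {n : ℕ} {P : Set (E n)}

lemma IsConvexPolytope.isCompact (hP : IsConvexPolytope P) : IsCompact P := by
  obtain ⟨V, rfl⟩ := hP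
  exact V.finite_toSet.isCompact_convexHull ℝ

lemma IsConvexPolytope.convex (hP : IsConvexPolytope P) : Convex ℝ P := by
  obtain ⟨V, rfl⟩ := hP
  exact convex_convexHull ℝ _

lemma IsConvexPolytope.finite_vert (hP : IsConvexPolytope P) : (vert P).Finite := by
  obtain ⟨V, rfl⟩ := hP
  exact V.finite_toSet.subset extremePoints_convexHull_subset

lemma inner_le_supportFn (hP : IsCompact P) {z : E n} (hz : z ∈ P) (u : E n) :
    inner ℝ z u ≤ supportFn P u :=
  le_csSup (hP.bddAbove_image (by fun_prop)) ⟨z, hz, rfl⟩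

lemma supportFn_eq_inner {y u : E n} (hy : y ∈ P) (hu : u ∈ normalCone P y) :
    supportFn P u = inner ℝ y u := by
  refine IsGreatest.csSup_eq ⟨⟨y, hy, rfl⟩, ?_⟩
  rintro _ ⟨z, hz, rfl⟩
  have := hu z hz
  rw [inner_sub_right] at this
  simp only [real_inner_comm u]
  linarith

lemma beta_le_supportFn (hP : IsCompact P) (hne : P.Nonempty) {u : E n} (hu : ‖u‖ = 1) :
    beta P ≤ supportFn P u := by
  obtain ⟨z, hz⟩ := hne
  refine csInf_le ⟨-‖z‖, ?_⟩ ⟨u, by simpa [unitSphere] using hu, rfl⟩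
  rintro _ ⟨w, hw, rfl⟩
  have hw1 : ‖w‖ = 1 := by simpa [unitSphere] using hw
  have h1 := inner_le_supportFn hP hz w
  have h2 := (abs_le.1 (abs_real_inner_le_norm z w)).1
  rw [hw1, mul_one] at h2
  linarith

lemma nonempty_of_beta_pos (h : 0 < beta P) : P.Nonempty := by
  by_contra hne
  rw [not_nonempty_iff_eq_empty] at hne
  subst hne
  have hz : ∀ x ∈ supportFn (∅ : Set (E n)) '' unitSphere n, x ≤ 0 := by
    rintro _ ⟨u, -, rfl⟩
    simp [supportFn]
  exact absurd h (not_lt.2 (Real.sInf_nonpos hz))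

/-- A hyperplane with normal `v` separating `z` from `P` would give `β ‖v‖ ≤ c < ⟨z, v⟩ ≤ ‖z‖ ‖v‖`,
against `‖z‖ < β`. -/
lemma ball_beta_subset (hc : Convex ℝ P) (hP : IsCompact P) (hβ : 0 < beta P) :
    ball 0 (beta P) ⊆ P := by
  intro z hz
  by_contra hzP
  obtain ⟨f, c, hfc, hcz⟩ := geometric_hahn_banach_closed_point hc hP.isClosed hzP
  set v := (InnerProductSpace.toDual ℝ (E n)).symm f with hv
  have hfv : ∀ z, f z = inner ℝ z v := fun z => by
    rw [real_inner_comm, hv, InnerProductSpace.toDual_symm_apply]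
  have hne := nonempty_of_beta_pos hβ
  have hv0 : v ≠ 0 := by
    intro h
    obtain ⟨a, ha⟩ := hne
    have := hfc a ha
    rw [hfv, h, inner_zero_right] at this hcz
    linarith
  have hvn : 0 < ‖v‖ := norm_pos_iff.2 hv0
  have h1 := beta_le_supportFn hP hne (norm_smul_inv_norm hv0 (𝕜 := ℝ))
  have h2 : supportFn P (((‖v‖ : ℝ))⁻¹ • v) ≤ ‖v‖⁻¹ * c := by
    refine csSup_le (hne.image _) ?_
    rintro _ ⟨a, ha, rfl⟩
    simp only [inner_smul_right]
    have := hfc a ha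
    rw [hfv] at this
    gcongr
  have h3 : inner ℝ z v ≤ ‖z‖ * ‖v‖ := real_inner_le_norm _ _
  rw [mem_ball_zero_iff] at hz
  rw [hfv] at hcz
  have h4 : beta P ≤ ‖v‖⁻¹ * c := h1.trans h2
  have h5 : beta P * ‖v‖ ≤ c := by
    calc beta P * ‖v‖ ≤ ‖v‖⁻¹ * c * ‖v‖ := by gcongr
      _ = c := by field_simp
  nlinarith

/-- The face of `P` in direction `u`. -/
def face (P : Set (E n)) (u : E n) : Set (E n) := {z | z ∈ P ∧ u ∈ normalCone P z}

lemma isClosed_setOf_mem_normalCone (P : Set (E n)) (u : E n) :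
    IsClosed {z | u ∈ normalCone P z} := by
  have : {z | u ∈ normalCone P z} = ⋂ z' ∈ P, {z | inner ℝ u (z' - z) ≤ 0} := by
    ext z
    simp [normalCone]
  rw [this]
  exact isClosed_biInter fun z _ => isClosed_le (by fun_prop) (by fun_prop)

lemma isCompact_face (hP : IsCompact P) (u : E n) : IsCompact (face P u) :=
  hP.inter_right (isClosed_setOf_mem_normalCone P u)

lemma inner_eq_of_mem_face {u y z : E n} (hy : y ∈ face P u) (hz : z ∈ face P u) :
    inner ℝ u y = inner ℝ u z := by
  have h1 := hy.2 z hz.1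
  have h2 := hz.2 y hy.1
  rw [inner_sub_right] at h1 h2
  linarith

lemma convex_face (hc : Convex ℝ P) (u : E n) : Convex ℝ (face P u) := by
  refine hc.inter fun x hx y hy a b ha hb hab z hz => ?_
  have h1 := hx z hz
  have h2 := hy z hz
  have : z - (a • x + b • y) = a • (z - x) + b • (z - y) := by
    have : z = (a + b) • z := by rw [hab, one_smul]
    nth_rewrite 1 [this]
    module
  rw [this, inner_add_right, inner_smul_right, inner_smul_right]
  have := mul_nonpos_of_nonneg_of_nonpos ha h1
  have := mul_nonpos_of_nonneg_of_nonpos hb h2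
  linarith

/-- A face is exposed, so its extreme points are vertices of `P`; Krein–Milman applies, and the hull
of finitely many points is already closed. -/
lemma face_eq_convexHull (hP : IsConvexPolytope P) (u : E n) :
    face P u = convexHull ℝ {v | v ∈ vert P ∧ u ∈ normalCone P v} := by
  refine Subset.antisymm ?_ (convexHull_min (fun v hv => ⟨extremePoints_subset hv.1, hv.2⟩)
    (convex_face hP.convex u))
  have hexp : IsExposed ℝ P (face P u) := by
    intro _
    refine ⟨InnerProductSpace.toDual ℝ (E n) u, ?_⟩
    ext z
    refine and_congr_right fun _ => forall₂_congr fun y _ => ?_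
    rw [InnerProductSpace.toDual_apply_apply, InnerProductSpace.toDual_apply_apply,
      inner_sub_right, sub_nonpos]
  have hsub : (face P u).extremePoints ℝ ⊆ {v | v ∈ vert P ∧ u ∈ normalCone P v} := fun v hv =>
    ⟨hexp.isExtreme.extremePoints_subset_extremePoints hv, (extremePoints_subset hv).2⟩
  have hfin : {v | v ∈ vert P ∧ u ∈ normalCone P v}.Finite :=
    hP.finite_vert.subset fun v hv => hv.1
  rw [← closure_convexHull_extremePoints (isCompact_face hP.isCompact u) (convex_face hP.convex u)]
  exact closure_minimal (convexHull_mono hsub) (hfin.isCompact_convexHull ℝ).isClosed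

/-- Each face is the hull of a subset of the finite vertex set, so there are finitely many; `F`
picks one direction for each. -/
lemma exists_finite_faces_cover (hP : IsConvexPolytope P) :
    ∃ F : Set (E n), F.Finite ∧ (∀ u ∈ F, ‖u‖ = 1) ∧
      ∀ u, ‖u‖ = 1 → ∃ u' ∈ F, face P u = face P u' := by
  have hfin : (face P '' sphere 0 1).Finite := by
    refine (hP.finite_vert.finite_subsets.image (convexHull ℝ)).subset ?_
    rintro _ ⟨u, -, rfl⟩
    exact ⟨_, fun v hv => hv.1, (face_eq_convexHull hP u).symm⟩
  obtain ⟨F, hF, hbij⟩ := exists_subset_bijOn (sphere (0 : E n) 1) (face P)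
  refine ⟨F, hbij.finite_iff_finite.2 hfin, fun u hu => by simpa using hF hu, fun u hu => ?_⟩
  obtain ⟨u', hu', h⟩ := hbij.surjOn ⟨u, by simpa using hu, rfl⟩
  exact ⟨u', hu', h.symm⟩

/-- The points of `face P u` around which the face contains a disc in the hyperplane `u^⊥`. -/
def flat (P : Set (E n)) (u : E n) : Set (E n) :=
  {y | ∃ ε > 0, ∀ w, inner ℝ u w = 0 → ‖w‖ < ε → y + w ∈ face P u}

lemma flat_subset_face (P : Set (E n)) (u : E n) : flat P u ⊆ face P u := by
  rintro y ⟨ε, hε, h⟩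
  simpa using h 0 (by simp) (by simpa using hε)

lemma finrank_orthogonal_span {u : E n} (hu : u ≠ 0) :
    Module.finrank ℝ (Submodule.span ℝ {u})ᗮ = n - 1 := by
  have h1 := (Submodule.span ℝ {u}).finrank_add_finrank_orthogonal
  rw [finrank_span_singleton hu, finrank_euclideanSpace_fin] at h1
  omega

lemma surfaceMeasure_image_orthogonal {u : E n} (hu : u ≠ 0) (y : E n)
    (s : Set (Submodule.span ℝ {u})ᗮ) :
    surfaceMeasure n ((fun w : (Submodule.span ℝ {u})ᗮ => y + (w : E n)) '' s) = volume s := by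
  have hiso : Isometry fun w : (Submodule.span ℝ {u})ᗮ => y + (w : E n) :=
    (isometry_add_left y).comp isometry_subtype_coe
  rw [surfaceMeasure, hiso.euclideanHausdorffMeasure_image, ← finrank_orthogonal_span hu,
    InnerProductSpace.euclideanHausdorffMeasure_eq_volume]

/-- Seen inside the hyperplane through the face, the difference is the frontier of a compact convex
set, which is Lebesgue null. This includes faces of dimension below `n - 1`, for which `flat` is
empty. -/
lemma face_diff_flat (hP : IsConvexPolytope P) {u : E n} (hu : u ≠ 0) :
    IsCompact (face P u \ flat P u) ∧ surfaceMeasure n (face P u \ flat P u) = 0 := by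
  rcases (face P u).eq_empty_or_nonempty with h | ⟨y, hy⟩
  · simp [h]
  set G : (Submodule.span ℝ {u})ᗮ → E n := fun w => y + (w : E n) with hG
  have hiso : Isometry G := (isometry_add_left y).comp isometry_subtype_coe
  have hGc : Continuous G := hiso.continuous
  set C := G ⁻¹' face P u with hC
  have hCconv : Convex ℝ C := by
    have : Convex ℝ ((fun z => y + z) ⁻¹' face P u) :=
      (convex_face hP.convex u).translate_preimage_right y
    exact this.linear_preimage (Submodule.span ℝ {u})ᗮ.subtype
  have hCcl : IsClosed C := (isCompact_face hP.isCompact u).isClosed.preimage hGc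
  have heq : face P u \ flat P u = G '' frontier C := by
    rw [hCcl.frontier_eq]
    ext z
    constructor
    · rintro ⟨hz, hzf⟩
      have hzw : inner ℝ u (z - y) = 0 := by
        rw [inner_sub_right, inner_eq_of_mem_face hz hy, sub_self]
      refine ⟨⟨z - y, Submodule.mem_orthogonal_singleton_iff_inner_right.2 hzw⟩, ⟨?_, ?_⟩, ?_⟩
      · simpa [hC, hG] using hz
      · intro hint
        refine hzf ?_
        obtain ⟨ε, hε, hb⟩ := Metric.mem_nhds_iff.1 (mem_interior_iff_mem_nhds.1 hint)
        refine ⟨ε, hε, fun w hw hwε => ?_⟩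
        have hmem : (⟨z - y + w, Submodule.mem_orthogonal_singleton_iff_inner_right.2
            (by rw [inner_add_right, hzw, hw, add_zero])⟩ : (Submodule.span ℝ {u})ᗮ) ∈ C := by
          refine hb ?_
          rw [mem_ball, Subtype.dist_eq, dist_eq_norm]
          simpa using hwε
        have : G ⟨z - y + w, Submodule.mem_orthogonal_singleton_iff_inner_right.2
            (by rw [inner_add_right, hzw, hw, add_zero])⟩ = z + w := by
          simp only [hG]; abel
        rw [← this]
        exact hmem
      · simp [hG]
    · rintro ⟨c, ⟨hc, hci⟩, rfl⟩
      refine ⟨hc, fun ⟨ε, hε, h⟩ => hci ?_⟩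
      rw [mem_interior_iff_mem_nhds, Metric.mem_nhds_iff]
      refine ⟨ε, hε, fun w hw => ?_⟩
      rw [mem_ball, Subtype.dist_eq, dist_eq_norm] at hw
      have hwc : inner ℝ u ((w : E n) - c) = 0 :=
        Submodule.mem_orthogonal_singleton_iff_inner_right.1 (w - c).2
      have := h _ hwc hw
      have h2 : G c + ((w : E n) - c) = G w := by simp only [hG]; abel
      rwa [h2] at this
  constructor
  · rw [heq]
    refine IsCompact.image ?_ hGc
    have hCcomp : IsCompact C := hiso.isClosedEmbedding.isCompact_preimage
      (isCompact_face hP.isCompact u)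
    exact hCcomp.of_isClosed_subset isClosed_frontier hCcl.frontier_subset
  · rw [heq, surfaceMeasure_image_orthogonal hu]
    exact hCconv.addHaar_frontier _

lemma measurableSet_flat (hP : IsConvexPolytope P) {u : E n} (hu : u ≠ 0) :
    MeasurableSet (flat P u) := by
  rw [← sdiff_sdiff_cancel_left (flat_subset_face P u)]
  exact (isCompact_face hP.isCompact u).isClosed.measurableSet.diff
    (face_diff_flat hP hu).1.isClosed.measurableSet

end Polytope

/-! ### Area of the unit sphere. -/

section Sphere

variable {n : ℕ}

lemma isOuterUnitNormal_closedBall {x u : E n} (hx : ‖x‖ = 1) :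
    IsOuterUnitNormal (closedBall 0 1) x u ↔ u = x := by
  constructor
  · rintro ⟨hu, h⟩
    have h1 := h u (by simp [hu])
    rw [inner_sub_right, real_inner_self_eq_norm_sq, hu] at h1
    have h2 := norm_sub_sq_real u x
    rw [hu, hx] at h2
    have : ‖u - x‖ = 0 := by nlinarith [norm_nonneg (u - x)]
    exact sub_eq_zero.1 (norm_eq_zero.1 this)
  · rintro rfl
    refine ⟨hx, fun z hz => ?_⟩
    rw [inner_sub_right, real_inner_self_eq_norm_sq, hx]
    have := real_inner_le_norm u z
    rw [hx, one_mul] at this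
    have : ‖z‖ ≤ 1 := by simpa using hz
    linarith

/-- For the unit ball the integrand of the cone volume formula is `1`, so the area is `n` times the
volume of the ball. -/
lemma surfaceMeasure_unitSphere_lt_top (hn : 1 ≤ n) : surfaceMeasure n (unitSphere n) < ∞ := by
  have hfr : frontier (closedBall (0 : E n) 1) = unitSphere n := frontier_closedBall 0 one_ne_zero
  have hx : ∀ x ∈ unitSphere n, ‖x‖ = 1 := fun x hx => by simpa [unitSphere] using hx
  have key := setLIntegral_inner_outerNormal hn (convex_closedBall (0 : E n) 1)
    (isCompact_closedBall 0 1) (closedBall_mem_nhds 0 one_pos)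
    (isClosed_frontier.measurableSet) subset_rfl (fun x hx' => by
      rw [hfr] at hx'
      exact ⟨x, (isOuterUnitNormal_closedBall (hx x hx')).2 rfl,
        fun u hu => (isOuterUnitNormal_closedBall (hx x hx')).1 hu⟩)
  rw [coneMeasure_frontier hn (convex_closedBall (0 : E n) 1)
    (isCompact_closedBall 0 1) (closedBall_mem_nhds 0 one_pos), hfr] at key
  have h1 : ∫⁻ x in unitSphere n, ENNReal.ofReal (inner ℝ x (outerNormal (closedBall 0 1) x))
      ∂(surfaceMeasure n) = surfaceMeasure n (unitSphere n) := by
    rw [← setLIntegral_one]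
    refine setLIntegral_congr_fun (isClosed_sphere.measurableSet) fun x hx' => ?_
    rw [outerNormal_eq ((isOuterUnitNormal_closedBall (hx x hx')).2 rfl)
      fun u hu => (isOuterUnitNormal_closedBall (hx x hx')).1 hu, real_inner_self_eq_norm_sq,
      hx x hx']
    simp
  rw [← h1, key]
  exact ENNReal.mul_lt_top (by simp) (isCompact_closedBall (0 : E n) 1).measure_lt_top

lemma surfaceMeasure_sphere_inter_hyperplane {w : E n} (hw : w ≠ 0) :
    surfaceMeasure n (unitSphere n ∩ {u | inner ℝ w u = 0}) = 0 := by
  have : unitSphere n ∩ {u | inner ℝ w u = 0} =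
      (fun x : (Submodule.span ℝ {w})ᗮ => 0 + (x : E n)) '' sphere 0 1 := by
    ext u
    constructor
    · rintro ⟨h1, h2⟩
      exact ⟨⟨u, Submodule.mem_orthogonal_singleton_iff_inner_right.2 h2⟩,
        by simpa [unitSphere] using h1, by simp⟩
    · rintro ⟨c, hc, rfl⟩
      refine ⟨by simpa [unitSphere] using hc, ?_⟩
      simp only [mem_ofPred_eq, zero_add]
      exact Submodule.mem_orthogonal_singleton_iff_inner_right.1 c.2
  rw [this, surfaceMeasure_image_orthogonal hw]
  exact Measure.addHaar_sphere_of_ne_zero _ _ one_ne_zero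

end Sphere

/-! ### Second-order behaviour of the boundary. -/

section Weingarten

variable {n : ℕ} {K : Set (E n)}

lemma orthogonalProjectionOnto_add_smul {u : E n} (w : (Submodule.span ℝ {u})ᗮ) (r : ℝ) :
    (Submodule.span ℝ {u})ᗮ.orthogonalProjectionOnto ((w : E n) + r • u) = w := by
  rw [map_add, map_smul, Submodule.orthogonalProjectionOnto_mem_subspace_eq_self,
    Submodule.orthogonalProjectionOnto_orthogonalComplement_singleton_eq_zero, smul_zero, add_zero]

lemma inner_coe_orthogonal {u : E n} (w : (Submodule.span ℝ {u})ᗮ) : inner ℝ u (w : E n) = 0 :=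
  Submodule.mem_orthogonal_singleton_iff_inner_right.1 w.2

/-- The second-order expansion along a curve in the boundary. -/
lemma IsWeingartenMap.tendsto_along {x u : E n}
    {S : (Submodule.span ℝ {u})ᗮ →ₗ[ℝ] (Submodule.span ℝ {u})ᗮ} (hS : IsWeingartenMap K x u S)
    (w : (Submodule.span ℝ {u})ᗮ) {r : ℝ → ℝ} {C : ℝ} (hr : ∀ᶠ s in 𝓝[>] 0, |r s| ≤ C * s)
    (hmem : ∀ᶠ s in 𝓝[>] (0 : ℝ), x + s • (w : E n) + r s • u ∈ frontier K) :
    Tendsto (fun s => -r s / s ^ 2) (𝓝[>] 0) (𝓝 (1 / 2 * inner ℝ (S w) w)) := by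
  have hu := hS.normal.1
  have hpos : ∀ᶠ s in 𝓝[>] (0 : ℝ), 0 < s := eventually_mem_nhdsWithin
  have hsub : ∀ s : ℝ, x + s • (w : E n) + r s • u - x = s • (w : E n) + r s • u := fun s => by abel
  have hid : Tendsto (fun s : ℝ => s) (𝓝[>] 0) (𝓝 0) := nhdsWithin_le_nhds
  have hbd : ∀ᶠ s in 𝓝[>] (0 : ℝ), ‖x + s • (w : E n) + r s • u - x‖ ≤ (‖w‖ + C) * s := by
    filter_upwards [hr, hpos] with s hs hs0
    rw [hsub]
    refine (norm_add_le _ _).trans ?_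
    rw [norm_smul, norm_smul, hu, mul_one, Real.norm_of_nonneg hs0.le, Real.norm_eq_abs,
      Submodule.coe_norm]
    linarith
  have htend : Tendsto (fun s : ℝ => x + s • (w : E n) + r s • u) (𝓝[>] 0) (𝓝[frontier K] x) := by
    refine tendsto_nhdsWithin_iff.2 ⟨?_, hmem⟩
    rw [tendsto_iff_norm_sub_tendsto_zero]
    refine squeeze_zero' (Eventually.of_forall fun _ => norm_nonneg _) hbd ?_
    simpa using hid.const_mul (‖w‖ + C)
  have hlo := hS.expansion.comp_tendsto htend
  have hO : ((fun y : E n => ‖y - x‖ ^ 2) ∘ fun s : ℝ => x + s • (w : E n) + r s • u)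
      =O[𝓝[>] 0] fun s : ℝ => s ^ 2 := by
    refine IsBigO.of_bound ((‖w‖ + C) ^ 2) ?_
    filter_upwards [hbd] with s hs
    rw [Function.comp_apply, Real.norm_of_nonneg (by positivity), Real.norm_of_nonneg (by positivity),
      ← mul_pow]
    gcongr
  have hlim := (hlo.trans_isBigO hO).tendsto_div_nhds_zero
  have hlim2 := hlim.add_const (1 / 2 * inner ℝ (S w) w)
  rw [zero_add] at hlim2
  refine hlim2.congr' ?_
  filter_upwards [hpos] with s hs
  have h1 : (Submodule.span ℝ {u})ᗮ.orthogonalProjectionOnto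
      (x + s • (w : E n) + r s • u - x) = s • w := by
    rw [hsub]
    exact orthogonalProjectionOnto_add_smul (s • w) (r s)
  have h2 : inner ℝ u (x - (x + s • (w : E n) + r s • u)) = -r s := by
    rw [← neg_sub, hsub, inner_neg_right, inner_add_right, inner_smul_right, inner_smul_right,
      inner_coe_orthogonal, real_inner_self_eq_norm_sq, hu]
    ring
  rw [Function.comp_apply, h1, h2, map_smul, inner_smul_left, inner_smul_right]
  simp only [conj_trivial]
  field_simp
  ring

lemma IsWeingartenMap.inner_eq_zero_of_segment {x u : E n}
    {S : (Submodule.span ℝ {u})ᗮ →ₗ[ℝ] (Submodule.span ℝ {u})ᗮ} (hS : IsWeingartenMap K x u S)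
    (w : (Submodule.span ℝ {u})ᗮ)
    (hmem : ∀ᶠ s in 𝓝[>] (0 : ℝ), x + s • (w : E n) ∈ frontier K) :
    inner ℝ (S w) w = 0 := by
  have := hS.tendsto_along w (r := fun _ => 0) (C := 0) (by simp) (by simpa using hmem)
  simp only [neg_zero, zero_div] at this
  have := tendsto_nhds_unique this tendsto_const_nhds
  linarith

/-- The expansion only sees boundary points, so a boundary curve in direction `w` is needed. The
inner ball supplies one at depth at most `s` over the displacement `s • w`, and depth is nonnegative
by the supporting hyperplane. -/
lemma IsWeingartenMap.inner_nonneg_of_ball (hK : IsCompact K) {x u : E n}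
    {S : (Submodule.span ℝ {u})ᗮ →ₗ[ℝ] (Submodule.span ℝ {u})ᗮ} (hS : IsWeingartenMap K x u S)
    {t : ℝ} (ht : 0 < t) (hb : closedBall (x - t • u) t ⊆ K) (w : (Submodule.span ℝ {u})ᗮ) :
    0 ≤ inner ℝ (S w) w := by
  have hu := hS.normal.1
  have hle : ∀ s r : ℝ, x + s • (w : E n) + r • u ∈ K → r ≤ 0 := by
    intro s r h
    have h1 := hS.normal.2 _ h
    have h2 : x + s • (w : E n) + r • u - x = s • (w : E n) + r • u := by abel
    rw [h2, inner_add_right, inner_smul_right, inner_smul_right,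
      inner_coe_orthogonal, real_inner_self_eq_norm_sq, hu] at h1
    linarith
  have hex : ∀ᶠ s in 𝓝[>] (0 : ℝ), ∃ r, |r| ≤ s ∧ x + s • (w : E n) + r • u ∈ frontier K := by
    -- This is what `s² ‖w‖² + (t - s)² ≤ t²` requires, i.e. that the point at depth `s` lies in the
    -- ball.
    have hsmall : ∀ᶠ s in 𝓝[>] (0 : ℝ), s < 2 * t / (‖w‖ ^ 2 + 1) :=
      nhdsWithin_le_nhds (Iio_mem_nhds (by positivity))
    filter_upwards [hsmall, eventually_mem_nhdsWithin] with s hs hs0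
    have hs0 : 0 < s := hs0
    have hin : x + s • (w : E n) + (-s) • u ∈ K := by
      refine hb ?_
      rw [mem_closedBall, dist_eq_norm]
      have h1 : x + s • (w : E n) + (-s) • u - (x - t • u) = s • (w : E n) + (t - s) • u := by
        module
      rw [h1]
      refine abs_le_of_sq_le_sq' ?_ ht.le |>.2
      rw [norm_add_sq_real, inner_smul_left, inner_smul_right, real_inner_comm,
        inner_coe_orthogonal, norm_smul, norm_smul, hu, Real.norm_eq_abs, Real.norm_eq_abs,
        mul_pow, mul_pow, sq_abs, sq_abs]
      have h2 : s * (‖(w : E n)‖ ^ 2 + 1) < 2 * t := by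
        rwa [lt_div_iff₀ (by positivity)] at hs
      simp only [mul_zero, add_zero, one_pow, mul_one]
      nlinarith
    have hcl : IsClosed {r : ℝ | x + s • (w : E n) + r • u ∈ K} :=
      hK.isClosed.preimage (by fun_prop : Continuous fun r : ℝ => x + s • (w : E n) + r • u)
    have hcomp : IsCompact ({r : ℝ | x + s • (w : E n) + r • u ∈ K} ∩ Ici (-s)) := by
      refine (isCompact_Icc (a := -s) (b := 0)).of_isClosed_subset (hcl.inter isClosed_Ici) ?_
      rintro r ⟨h1, h2⟩
      exact ⟨h2, hle s r h1⟩
    -- The highest point of `K` on this line is a boundary point, since an interior point could be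
    -- raised further.
    obtain ⟨r, ⟨hrK, hrs⟩, hmax⟩ := hcomp.exists_isGreatest ⟨-s, hin, self_mem_Ici⟩
    refine ⟨r, abs_le.2 ⟨hrs, (hle s r hrK).trans hs0.le⟩, subset_closure hrK, fun hint => ?_⟩
    have htd : Tendsto (fun ε : ℝ => x + s • (w : E n) + (r + ε) • u) (𝓝[>] 0)
        (𝓝 (x + s • (w : E n) + r • u)) := by
      have : Continuous fun ε : ℝ => x + s • (w : E n) + (r + ε) • u := by fun_prop
      have := this.tendsto 0
      simp only [add_zero] at this
      exact this.mono_left nhdsWithin_le_nhds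
    obtain ⟨ε, hε, hε0⟩ := ((htd.eventually (mem_interior_iff_mem_nhds.1 hint)).and
      eventually_mem_nhdsWithin).exists
    have hε0 : 0 < ε := hε0
    have hrs' : -s ≤ r := hrs
    have := hmax ⟨hε, (by linarith : -s ≤ r + ε)⟩
    linarith
  obtain ⟨r, hr⟩ : ∃ r : ℝ → ℝ, ∀ᶠ s in 𝓝[>] (0 : ℝ),
      |r s| ≤ s ∧ x + s • (w : E n) + r s • u ∈ frontier K := by
    classical
    refine ⟨fun s => if h : ∃ r, |r| ≤ s ∧ x + s • (w : E n) + r • u ∈ frontier K then h.choose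
      else 0, hex.mono fun s hs => ?_⟩
    simp only [dif_pos hs]
    exact hs.choose_spec
  have hlim := hS.tendsto_along w (r := r) (C := 1) (hr.mono fun s hs => by simpa using hs.1)
    (hr.mono fun s hs => hs.2)
  have := ge_of_tendsto hlim (hr.mono fun s hs => by
    have := hle s _ (hK.isClosed.frontier_subset hs.2)
    exact div_nonneg (by linarith) (sq_nonneg s) : ∀ᶠ s in 𝓝[>] (0 : ℝ), 0 ≤ -r s / s ^ 2)
  linarith

/-- The default value `0` covers the points without a Weingarten map, so the vanishing of the
curvature needs no existence proof. -/
lemma gaussCurvature_eq_zero {x : E n}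
    (h : ∀ S, IsWeingartenMap K x (outerNormal K x) S → LinearMap.det S = 0) :
    gaussCurvature K x = 0 := by
  unfold gaussCurvature
  split_ifs with hex
  · exact h _ hex.choose_spec
  · rfl

/-- At `w - l • S w` the form equals `-2 l ‖S w‖² + l² Q`, negative for small `l > 0` unless `S w =
0`. The choice `l = a / (Q + 1)` avoids the case `Q = 0`. -/
lemma map_eq_zero_of_inner_eq_zero {V : Type*} [NormedAddCommGroup V] [InnerProductSpace ℝ V]
    {S : V →ₗ[ℝ] V} (hS : S.IsSymmetric) (hpos : ∀ z, 0 ≤ inner ℝ (S z) z) {w : V}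
    (hw : inner ℝ (S w) w = 0) : S w = 0 := by
  set a := ‖S w‖ ^ 2 with ha
  set Q := inner ℝ (S (S w)) (S w) with hQ
  have hQ0 : 0 ≤ Q := hpos _
  have key : ∀ l : ℝ, 0 ≤ -2 * l * a + l ^ 2 * Q := by
    intro l
    have h1 := hpos (w - l • S w)
    have h2 : inner ℝ (S (S w)) w = a := by rw [hS, real_inner_self_eq_norm_sq]
    rw [map_sub, map_smul, inner_sub_left, inner_sub_right, inner_sub_right, hw, inner_smul_left,
      inner_smul_right, inner_smul_left, inner_smul_right, h2, ← hQ,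
      real_inner_self_eq_norm_sq] at h1
    simp only [conj_trivial] at h1
    nlinarith
  have h3 := key (a / (Q + 1))
  have h4 : -2 * (a / (Q + 1)) * a + (a / (Q + 1)) ^ 2 * Q = -(a ^ 2 * (Q + 2)) / (Q + 1) ^ 2 := by
    field_simp
    ring
  rw [h4] at h3
  have h5 : 0 ≤ -(a ^ 2 * (Q + 2)) := by
    by_contra hcon
    exact absurd (div_neg_of_neg_of_pos (not_le.1 hcon) (by positivity)) (not_lt.2 h3)
  have h6 : a ^ 2 = 0 := by nlinarith [sq_nonneg a]
  have h7 : a = 0 := by simpa using h6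
  simpa [ha] using h7

end Weingarten

/-! ### Boundary and normals of the parallel body; points of zero curvature. -/

section ParallelBody

variable {n : ℕ} {P : Set (E n)} {t : ℝ}

lemma mem_parallel {x : E n} :
    x ∈ P + t • unitBall n ↔ ∃ y ∈ P, ∃ b : E n, ‖b‖ ≤ 1 ∧ y + t • b = x := by
  rw [Set.mem_add]
  constructor
  · rintro ⟨y, hy, _, ⟨b, hb, rfl⟩, rfl⟩
    exact ⟨y, hy, b, by simpa [unitBall] using hb, rfl⟩
  · rintro ⟨y, hy, b, hb, rfl⟩
    exact ⟨y, hy, _, ⟨b, by simpa [unitBall] using hb, rfl⟩, rfl⟩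

lemma isCompact_parallel (hP : IsCompact P) (t : ℝ) : IsCompact (P + t • unitBall n) :=
  hP.add ((isCompact_closedBall 0 1).smul t)

lemma convex_parallel (hP : Convex ℝ P) (t : ℝ) : Convex ℝ (P + t • unitBall n) :=
  hP.add ((convex_closedBall 0 1).smul t)

lemma subset_parallel (P : Set (E n)) (t : ℝ) : P ⊆ P + t • unitBall n := fun y hy =>
  mem_parallel.2 ⟨y, hy, 0, by simp, by simp⟩

lemma isOuterUnitNormal_parallel (ht : 0 ≤ t) {y u : E n} (hu : ‖u‖ = 1)
    (huy : u ∈ normalCone P y) : IsOuterUnitNormal (P + t • unitBall n) (y + t • u) u := by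
  refine ⟨hu, fun z hz => ?_⟩
  obtain ⟨y', hy', b, hb, rfl⟩ := mem_parallel.1 hz
  have h1 := huy y' hy'
  have h2 : y' + t • b - (y + t • u) = (y' - y) + t • (b - u) := by module
  have h3 : inner ℝ u b ≤ 1 := (real_inner_le_norm u b).trans (by rw [hu]; linarith)
  rw [h2, inner_add_right, inner_smul_right, inner_sub_right u b u, real_inner_self_eq_norm_sq, hu]
  have := mul_nonpos_of_nonneg_of_nonpos ht (by linarith : inner ℝ u b - 1 ≤ 0)
  linarith

lemma mem_frontier_parallel (ht : 0 ≤ t) {y u : E n} (hu : ‖u‖ = 1) (hy : y ∈ P)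
    (huy : u ∈ normalCone P y) : y + t • u ∈ frontier (P + t • unitBall n) :=
  (isOuterUnitNormal_parallel ht hu huy).mem_frontier (mem_parallel.2 ⟨y, hy, u, hu.le, rfl⟩)

/-- Write `x = y + t • b`. Varying the `P`-summand shows that `u` is normal at `y`; varying the ball
summand shows that `b` maximises `⟨u, ·⟩` on the ball, so `b = u` (irrelevant if `t = 0`). -/
lemma IsOuterUnitNormal.exists_eq_parallel (ht : 0 ≤ t) {x u : E n} (hx : x ∈ P + t • unitBall n)
    (hu : IsOuterUnitNormal (P + t • unitBall n) x u) :
    ∃ y ∈ P, x = y + t • u ∧ u ∈ normalCone P y := by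
  obtain ⟨y, hy, b, hb, rfl⟩ := mem_parallel.1 hx
  have hn : u ∈ normalCone P y := fun z hz => by
    have := hu.2 _ (mem_parallel.2 ⟨z, hz, b, hb, rfl⟩)
    rwa [add_sub_add_right_eq_sub] at this
  refine ⟨y, hy, ?_, hn⟩
  rcases ht.eq_or_lt with rfl | ht
  · simp
  · have h1 := hu.2 _ (mem_parallel.2 ⟨y, hy, u, hu.1.le, rfl⟩)
    rw [add_sub_add_left_eq_sub, ← smul_sub, inner_smul_right, inner_sub_right,
      real_inner_self_eq_norm_sq, hu.1] at h1
    have h2 : 1 ≤ inner ℝ u b := by nlinarith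
    have h3 := norm_sub_sq_real u b
    rw [hu.1] at h3
    have h4 : ‖u - b‖ = 0 := by nlinarith [norm_nonneg (u - b), norm_nonneg b]
    rw [sub_eq_zero.1 (norm_eq_zero.1 h4)]

lemma exists_eq_of_mem_frontier_parallel (hP : Convex ℝ P) (hPc : IsCompact P) (h0 : P ∈ 𝓝 0)
    (ht : 0 ≤ t) {x : E n} (hx : x ∈ frontier (P + t • unitBall n)) :
    ∃ y ∈ P, ∃ u, ‖u‖ = 1 ∧ x = y + t • u ∧ u ∈ normalCone P y := by
  obtain ⟨u, hu⟩ := exists_isOuterUnitNormal (convex_parallel hP t)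
    (mem_of_superset h0 (subset_parallel P t)) hx
  obtain ⟨y, hy, h1, h2⟩ := hu.exists_eq_parallel ht
    ((isCompact_parallel hPc t).isClosed.frontier_subset hx)
  exact ⟨y, hy, u, hu.1, h1, h2⟩

/-- Normals are monotone, `⟨u' - u, y' - y⟩ ≥ 0`; Cauchy–Schwarz then gives the bound. For `t > 0`
it says that the Gauss map of the parallel body is `1/t`-Lipschitz. -/
lemma norm_normal_sub_le {y u y' u' : E n} (hy : y ∈ P)
    (hu : u ∈ normalCone P y) (hy' : y' ∈ P) (hu' : u' ∈ normalCone P y') :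
    t * ‖u' - u‖ ≤ ‖(y' + t • u') - (y + t • u)‖ := by
  have h1 := hu y' hy'
  have h2 := hu' y hy
  have h3 : (y' + t • u') - (y + t • u) = (y' - y) + t • (u' - u) := by module
  have h4 : inner ℝ (u' - u) ((y' + t • u') - (y + t • u)) =
      - inner ℝ u' (y - y') - inner ℝ u (y' - y) + t * ‖u' - u‖ ^ 2 := by
    rw [h3, inner_add_right, inner_smul_right, real_inner_self_eq_norm_sq, inner_sub_left,
      ← inner_neg_right, neg_sub]
  have h5 := real_inner_le_norm (u' - u) ((y' + t • u') - (y + t • u))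
  rcases (norm_nonneg (u' - u)).eq_or_lt with h0 | h0
  · rw [← h0, mul_zero]; exact norm_nonneg _
  · have : ‖u' - u‖ * (t * ‖u' - u‖) ≤ ‖u' - u‖ * ‖(y' + t • u') - (y + t • u)‖ := by nlinarith
    exact le_of_mul_le_mul_left this h0

lemma eq_of_parallel_eq (ht : 0 < t) {y u y' u' : E n} (hy : y ∈ P)
    (hu : u ∈ normalCone P y) (hy' : y' ∈ P) (hu' : u' ∈ normalCone P y')
    (h : y' + t • u' = y + t • u) : u' = u ∧ y' = y := by
  have h1 := norm_normal_sub_le (t := t) hy hu hy' hu'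
  rw [h, sub_self, norm_zero] at h1
  have h2 : ‖u' - u‖ = 0 := by
    by_contra hne
    have := mul_pos ht (lt_of_le_of_ne (norm_nonneg _) (Ne.symm hne))
    linarith
  have h3 : u' = u := sub_eq_zero.1 (norm_eq_zero.1 h2)
  subst h3
  exact ⟨rfl, add_right_cancel h⟩

lemma unique_normal_parallel (ht : 0 < t) {y u : E n} (hy : y ∈ P) (hu : ‖u‖ = 1)
    (huy : u ∈ normalCone P y) {u' : E n}
    (hu' : IsOuterUnitNormal (P + t • unitBall n) (y + t • u) u') : u' = u := by
  obtain ⟨y', hy', h1, h2⟩ := hu'.exists_eq_parallel ht.le (mem_parallel.2 ⟨y, hy, u, hu.le, rfl⟩)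
  exact (eq_of_parallel_eq ht hy huy hy' h2 h1.symm).1

lemma outerNormal_parallel (ht : 0 < t) {y u : E n} (hy : y ∈ P) (hu : ‖u‖ = 1)
    (huy : u ∈ normalCone P y) : outerNormal (P + t • unitBall n) (y + t • u) = u :=
  outerNormal_eq (isOuterUnitNormal_parallel ht.le hu huy)
    fun _ h => unique_normal_parallel ht hy hu huy h

/-- A non-vertex is interior to a segment of `P`, and `u` is orthogonal to it. The translated
segment lies in the boundary, so the quadratic form vanishes on its direction; the ball of radius
`t` about `y` makes the form semidefinite, so that direction lies in the kernel. -/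
lemma gaussCurvature_parallel_of_not_vert (hPc : IsCompact P) (hPconv : Convex ℝ P) (ht : 0 < t)
    {y u : E n} (hy : y ∈ P) (hu : ‖u‖ = 1) (huy : u ∈ normalCone P y) (hyv : y ∉ vert P) :
    gaussCurvature (P + t • unitBall n) (y + t • u) = 0 := by
  refine gaussCurvature_eq_zero ?_
  rw [outerNormal_parallel ht hy hu huy]
  intro S hS
  have hex : ∃ a ∈ P, ∃ b ∈ P, y ∈ openSegment ℝ a b ∧ a ≠ y := by
    by_contra! hcon
    exact hyv ⟨hy, fun a ha b hb hab => hcon a ha b hb hab⟩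
  obtain ⟨a, ha, b, hb, ⟨p, q, hp, hq, hpq, rfl⟩, hay⟩ := hex
  set y := p • a + q • b with hydef
  have h1 := huy a ha
  have h2 := huy b hb
  have h3 : p • (a - y) + q • (b - y) = 0 := by
    have : p • (a - y) + q • (b - y) = (p • a + q • b) - (p + q) • y := by module
    rw [this, hpq, one_smul, ← hydef, sub_self]
  have h4 : p * inner ℝ u (a - y) + q * inner ℝ u (b - y) = 0 := by
    rw [← inner_smul_right, ← inner_smul_right, ← inner_add_right, h3, inner_zero_right]
  have h5 : inner ℝ u (a - y) = 0 := by nlinarith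
  set w : (Submodule.span ℝ {u})ᗮ :=
    ⟨a - y, Submodule.mem_orthogonal_singleton_iff_inner_right.2 h5⟩ with hw
  have hw0 : w ≠ 0 := fun h => hay (sub_eq_zero.1 (congrArg Subtype.val h))
  have hq0 : inner ℝ (S w) w = 0 := by
    refine hS.inner_eq_zero_of_segment w ?_
    have hsmall : ∀ᶠ s in 𝓝[>] (0 : ℝ), s < 1 := nhdsWithin_le_nhds (Iio_mem_nhds one_pos)
    filter_upwards [hsmall, eventually_mem_nhdsWithin] with s hs hs0
    have hs0 : 0 < s := hs0
    have heq : y + t • u + s • (w : E n) = (y + s • (a - y)) + t • u := by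
      rw [hw]; simp only; abel
    have hmem : y + s • (a - y) ∈ P := by
      have := hPconv hy ha (sub_nonneg.2 hs.le) hs0.le (by ring)
      convert this using 1
      module
    rw [heq]
    refine mem_frontier_parallel ht.le hu hmem fun z hz => ?_
    have h6 : z - (y + s • (a - y)) = (z - y) - s • (a - y) := by abel
    rw [h6, inner_sub_right, inner_smul_right, h5, mul_zero, sub_zero]
    exact huy z hz
  have hball : closedBall (y + t • u - t • u) t ⊆ P + t • unitBall n := by
    intro z hz
    rw [add_sub_cancel_right, mem_closedBall, dist_eq_norm] at hz
    refine mem_parallel.2 ⟨y, hy, t⁻¹ • (z - y), ?_, ?_⟩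
    · rw [norm_smul, norm_inv, Real.norm_of_nonneg ht.le, inv_mul_le_one₀ ht]
      exact hz
    · rw [smul_smul, mul_inv_cancel₀ ht.ne', one_smul, add_sub_cancel]
  have hSw := map_eq_zero_of_inner_eq_zero hS.symmetric
    (hS.inner_nonneg_of_ball (isCompact_parallel hPc t) ht hball) hq0
  by_contra hdet
  have := (LinearMap.equivOfDetNeZero S hdet).injective
  exact hw0 (this ((by simpa using hSw)))

/-- At a point over the relative interior of a facet. -/
lemma flat_parallel (hn : 2 ≤ n) (h0 : P ∈ 𝓝 0) (ht : 0 ≤ t) {y u : E n} (hu : ‖u‖ = 1)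
    (hy : y ∈ flat P u) :
    (∀ u', IsOuterUnitNormal (P + t • unitBall n) (y + t • u) u' → u' = u) ∧
      gaussCurvature (P + t • unitBall n) (y + t • u) = 0 := by
  have hyf := flat_subset_face P u hy
  obtain ⟨ε, hε, hflat⟩ := hy
  have hu0 : u ≠ 0 := by rintro rfl; simp at hu
  have huniq : ∀ u', IsOuterUnitNormal (P + t • unitBall n) (y + t • u) u' → u' = u := by
    intro u' hu'
    obtain ⟨ρ, hρ, hball⟩ := Metric.mem_nhds_iff.1 h0
    have hballc : closedBall 0 (ρ / 2) ⊆ P + t • unitBall n :=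
      ((closedBall_subset_ball (by linarith)).trans hball).trans (subset_parallel P t)
    have hp1 := (isOuterUnitNormal_parallel ht hu hyf.2).le_inner (by positivity) hballc
    have hp2 := hu'.le_inner (by positivity) hballc
    -- The disc in the face allows testing `u'` against both `w` and `-w`, which forces `w = 0` and
    -- `u' = ±u`. The minus sign is excluded because both normals have positive inner product with
    -- the point.
    set w := u' - (inner ℝ u u' : ℝ) • u with hw
    have hwu : inner ℝ u w = 0 := by
      rw [hw, inner_sub_right, inner_smul_right, real_inner_self_eq_norm_sq, hu]; ring
    have hle : ∀ w', inner ℝ u w' = 0 → inner ℝ u' w' ≤ 0 := by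
      intro w' hw'
      set δ := ε / (‖w'‖ + 1) / 2 with hδ
      have hδ0 : 0 < δ := by positivity
      have hmem := hflat (δ • w') (by rw [inner_smul_right, hw', mul_zero]) (by
        rw [norm_smul, Real.norm_of_nonneg hδ0.le, hδ, div_div, div_mul_eq_mul_div,
          div_lt_iff₀ (by positivity)]
        nlinarith [norm_nonneg w'])
      have := hu'.2 _ (mem_parallel.2 ⟨_, hmem.1, u, hu.le, rfl⟩)
      rw [show y + δ • w' + t • u - (y + t • u) = δ • w' by abel, inner_smul_right] at this
      by_contra hcon
      have := mul_pos hδ0 (not_le.1 hcon)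
      linarith
    have h1 : inner ℝ u' w = 0 := by
      refine le_antisymm (hle w hwu) ?_
      have := hle (-w) (by rw [inner_neg_right, hwu, neg_zero])
      rw [inner_neg_right] at this
      linarith
    have h2 : inner ℝ w w = 0 := by
      nth_rewrite 1 [hw]
      rw [inner_sub_left, inner_smul_left, h1, hwu]; simp
    have h3 : u' = (inner ℝ u u' : ℝ) • u := sub_eq_zero.1 (inner_self_eq_zero.1 h2)
    set c := inner ℝ u u' with hc
    have h4 : |c| = 1 := by
      have := hu'.1
      rw [h3, norm_smul, hu, mul_one] at this
      exact this
    rcases eq_or_eq_neg_of_abs_eq h4 with h5 | h5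
    · rw [h3, h5, one_smul]
    · rw [h3, h5, neg_one_smul, inner_neg_left] at hp2
      linarith
  refine ⟨huniq, gaussCurvature_eq_zero ?_⟩
  rw [outerNormal_eq (isOuterUnitNormal_parallel ht hu hyf.2) huniq]
  intro S hS
  have hS0 : S = 0 := by
    refine hS.symmetric.inner_map_self_eq_zero.1 fun w => ?_
    refine hS.inner_eq_zero_of_segment w ?_
    have hsmall : ∀ᶠ s in 𝓝[>] (0 : ℝ), s * ‖(w : E n)‖ < ε := by
      have : Tendsto (fun s : ℝ => s * ‖(w : E n)‖) (𝓝[>] 0) (𝓝 0) := by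
        have : Continuous fun s : ℝ => s * ‖(w : E n)‖ := by fun_prop
        have := this.tendsto 0
        rw [zero_mul] at this
        exact this.mono_left nhdsWithin_le_nhds
      exact this.eventually (Iio_mem_nhds hε)
    filter_upwards [hsmall, eventually_mem_nhdsWithin] with s hs hs0
    have hs0 : 0 < s := hs0
    have hmem := hflat (s • (w : E n)) (by rw [inner_smul_right, inner_coe_orthogonal, mul_zero])
      (by rwa [norm_smul, Real.norm_of_nonneg hs0.le])
    rw [show y + t • u + s • (w : E n) = (y + s • (w : E n)) + t • u by abel]
    exact mem_frontier_parallel ht hu hmem.1 hmem.2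
  -- The determinant is `0 ^ (n - 1)`, which vanishes because `n ≥ 2`.
  rw [hS0, LinearMap.det_zero, finrank_orthogonal_span hu0, zero_pow (by omega)]

end ParallelBody

/-! ### Curvature over the vertices. -/

section SphericalPart

variable {n : ℕ} {P : Set (E n)} {t : ℝ}

/-- The open set of directions in which `v` is the only vertex at which the maximum is attained. -/
def strictNormalCone (P : Set (E n)) (v : E n) : Set (E n) :=
  {u | ∀ v' ∈ vert P, v' ≠ v → inner ℝ u (v' - v) < 0}

lemma isOpen_strictNormalCone (hP : IsConvexPolytope P) (v : E n) :
    IsOpen (strictNormalCone P v) := by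
  have : strictNormalCone P v = ⋂ v' ∈ vert P \ {v}, {u | inner ℝ u (v' - v) < 0} := by
    ext u
    simp [strictNormalCone]
  rw [this]
  exact (hP.finite_vert.subset sdiff_subset).isOpen_biInter
    fun v' _ => isOpen_lt (by fun_prop) continuous_const

/-- The face in direction `0` is all of `P`. -/
lemma convexHull_vert (hP : IsConvexPolytope P) : convexHull ℝ (vert P) = P := by
  have h := face_eq_convexHull hP 0
  have h1 : face P 0 = P := by
    ext z
    simp [face, normalCone]
  have h2 : {v | v ∈ vert P ∧ (0 : E n) ∈ normalCone P v} = vert P := by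
    ext z
    simp [normalCone]
  rw [h1, h2] at h
  exact h.symm

lemma strictNormalCone_subset (hP : IsConvexPolytope P) (v : E n) :
    strictNormalCone P v ⊆ normalCone P v := by
  intro u hu z hz
  rw [← convexHull_vert hP] at hz
  refine convexHull_min (t := {z | inner ℝ u (z - v) ≤ 0}) ?_ ?_ hz
  · intro v' hv'
    rcases eq_or_ne v' v with rfl | hne
    · simp
    · exact (hu v' hv' hne).le
  · have : {z | inner ℝ u (z - v) ≤ 0} = {z | inner ℝ u z ≤ inner ℝ u v} := by
      ext z
      simp [inner_sub_right]
    rw [this]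
    exact convex_halfSpace_le ⟨fun x y => inner_add_right _ _ _, fun c x => inner_smul_right _ _ _⟩ _

lemma eq_of_mem_strictNormalCone (hP : IsConvexPolytope P) {v u z : E n} (hv : v ∈ vert P)
    (hu : u ∈ strictNormalCone P v) (hz : z ∈ P) (huz : u ∈ normalCone P z) : z = v := by
  have hz' : z ∈ face P u := ⟨hz, huz⟩
  rw [face_eq_convexHull hP] at hz'
  have : {v' | v' ∈ vert P ∧ u ∈ normalCone P v'} ⊆ {v} := by
    rintro v' ⟨hv', huv'⟩
    by_contra hne
    have h1 := hu v' hv' hne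
    have h2 := huv' v (extremePoints_subset hv)
    rw [inner_sub_right] at h1 h2
    linarith
  simpa using convexHull_mono this hz'

/-- The strict cone is open and normals vary continuously, so nearby boundary points are `v + t •
u'`. For the displacement `z` to such a point and `a = ⟨u, z⟩` one has `‖z‖² = -2ta`, and the error
of the expansion is `a²/(2t) = ‖z‖⁴/(8t³)`. -/
lemma isWeingartenMap_spherical (hP : IsConvexPolytope P) (hPm : P ∈ 𝓝 0) (ht : 0 < t) {v u : E n}
    (hv : v ∈ vert P) (hu : ‖u‖ = 1) (huv : u ∈ strictNormalCone P v) :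
    IsWeingartenMap (P + t • unitBall n) (v + t • u) u (t⁻¹ • LinearMap.id) := by
  have hvP : v ∈ P := extremePoints_subset hv
  have huN := strictNormalCone_subset hP v huv
  refine ⟨isOuterUnitNormal_parallel ht.le hu huN, fun x y => by
    simp [inner_smul_left, inner_smul_right], ?_⟩
  have hloc : ∀ᶠ y in 𝓝[frontier (P + t • unitBall n)] (v + t • u),
      ∃ u', ‖u'‖ = 1 ∧ y = v + t • u' := by
    obtain ⟨δ, hδ, hball⟩ := Metric.isOpen_iff.1 (isOpen_strictNormalCone hP v) u huv
    have hnear : ∀ᶠ y in 𝓝[frontier (P + t • unitBall n)] (v + t • u),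
        y ∈ ball (v + t • u) (t * δ) :=
      nhdsWithin_le_nhds (ball_mem_nhds _ (by positivity))
    filter_upwards [hnear, eventually_mem_nhdsWithin] with y hy hyf
    obtain ⟨q, hq, u', hu', rfl, hN⟩ := exists_eq_of_mem_frontier_parallel hP.convex hP.isCompact
      hPm ht.le hyf
    have h1 := norm_normal_sub_le (t := t) hvP huN hq hN
    rw [mem_ball, dist_eq_norm] at hy
    have h2 : ‖u' - u‖ < δ := lt_of_mul_lt_mul_left (h1.trans_lt hy) ht.le
    have h3 : u' ∈ strictNormalCone P v := hball (by rwa [mem_ball, dist_eq_norm])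
    rw [eq_of_mem_strictNormalCone hP hv h3 hq hN]
    exact ⟨u', hu', rfl⟩
  rw [isLittleO_iff]
  intro c hc
  have hsmall : ∀ᶠ y in 𝓝[frontier (P + t • unitBall n)] (v + t • u),
      ‖y - (v + t • u)‖ ^ 2 < 8 * t ^ 3 * c := by
    have hcont : Continuous fun y : E n => ‖y - (v + t • u)‖ ^ 2 := by fun_prop
    have h := hcont.tendsto (v + t • u)
    simp only [sub_self, norm_zero, ne_eq, OfNat.ofNat_ne_zero, not_false_eq_true, zero_pow] at h
    exact (h.mono_left nhdsWithin_le_nhds).eventually (Iio_mem_nhds (by positivity))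
  filter_upwards [hloc, hsmall] with y hy hys
  obtain ⟨u', hu', rfl⟩ := hy
  set z := v + t • u' - (v + t • u) with hz
  have hz' : z = t • (u' - u) := by rw [hz]; module
  obtain ⟨a, ha⟩ : ∃ a, a = inner ℝ u z := ⟨_, rfl⟩
  have hza : ‖z‖ ^ 2 = -2 * t * a := by
    rw [ha, hz', norm_smul, mul_pow, Real.norm_of_nonneg ht.le, norm_sub_sq_real, hu, hu',
      inner_smul_right, inner_sub_right, real_inner_self_eq_norm_sq, hu, real_inner_comm]
    ring
  obtain ⟨w, hw⟩ : ∃ w : (Submodule.span ℝ {u})ᗮ, (w : E n) = z - a • u :=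
    ⟨⟨z - a • u, Submodule.mem_orthogonal_singleton_iff_inner_right.2 (by
      rw [inner_sub_right, inner_smul_right, real_inner_self_eq_norm_sq, hu, ha]; ring)⟩, rfl⟩
  have hproj : (Submodule.span ℝ {u})ᗮ.orthogonalProjectionOnto z = w := by
    rw [← orthogonalProjectionOnto_add_smul w a, hw, sub_add_cancel]
  rw [← neg_sub (v + t • u') (v + t • u), ← hz, hproj, inner_neg_right, ← ha,
    LinearMap.smul_apply, LinearMap.id_apply, inner_smul_left, real_inner_self_eq_norm_sq,
    Submodule.coe_norm, hw]
  rw [norm_sub_sq_real, inner_smul_right, real_inner_comm, ← ha, norm_smul, hu, hza]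
  have h1 : -a - 1 / 2 * ((starRingEnd ℝ) t⁻¹ * (-2 * t * a - 2 * (a * a) + (‖a‖ * 1) ^ 2)) =
      a ^ 2 / (2 * t) := by
    rw [Real.norm_eq_abs, mul_one, sq_abs, conj_trivial]
    field_simp
    ring
  rw [h1, Real.norm_of_nonneg (by positivity), ← hza, Real.norm_of_nonneg (by positivity)]
  have h2 : a ^ 2 / (2 * t) = ‖z‖ ^ 2 * ‖z‖ ^ 2 / (8 * t ^ 3) := by
    rw [hza]; field_simp; ring
  rw [h2, div_le_iff₀ (by positivity)]
  nlinarith [sq_nonneg ‖z‖]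

/-- Uniqueness is needed because `gaussCurvature` takes a chosen map. Along the spherical arc `v + s
w + √(t² - s²‖w‖²) u` the depth divided by `s²` tends to `‖w‖²/(2t)`, which fixes the quadratic form
and hence the symmetric map. -/
lemma IsWeingartenMap.eq_of_spherical (hP : IsConvexPolytope P) (ht : 0 < t) {v u : E n}
    (hv : v ∈ vert P) (hu : ‖u‖ = 1) (huv : u ∈ strictNormalCone P v)
    {S : (Submodule.span ℝ {u})ᗮ →ₗ[ℝ] (Submodule.span ℝ {u})ᗮ}
    (hS : IsWeingartenMap (P + t • unitBall n) (v + t • u) u S) :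
    S = t⁻¹ • LinearMap.id := by
  have hvP : v ∈ P := extremePoints_subset hv
  have hid : (t⁻¹ • LinearMap.id :
      (Submodule.span ℝ {u})ᗮ →ₗ[ℝ] (Submodule.span ℝ {u})ᗮ).IsSymmetric := fun x y => by
    simp [inner_smul_left, inner_smul_right]
  rw [← sub_eq_zero]
  refine (hS.symmetric.sub hid).inner_map_self_eq_zero.1 fun w => ?_
  set N := ‖(w : E n)‖ ^ 2 with hN
  set ρ : ℝ → ℝ := fun s => √(t ^ 2 - s ^ 2 * N) with hρ
  have hρc : Tendsto ρ (𝓝[>] 0) (𝓝 t) := by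
    have : Continuous ρ := by fun_prop
    have := this.tendsto 0
    have h0 : ρ 0 = t := by simp [hρ, Real.sqrt_sq ht.le]
    rw [h0] at this
    exact this.mono_left nhdsWithin_le_nhds
  have hpos : ∀ᶠ s in 𝓝[>] (0 : ℝ), 0 < s := eventually_mem_nhdsWithin
  have hle1 : ∀ᶠ s in 𝓝[>] (0 : ℝ), s < 1 := nhdsWithin_le_nhds (Iio_mem_nhds one_pos)
  have hsq : ∀ᶠ s in 𝓝[>] (0 : ℝ), 0 ≤ ρ s ∧ ρ s ^ 2 = t ^ 2 - s ^ 2 * N := by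
    have : Tendsto (fun s : ℝ => t ^ 2 - s ^ 2 * N) (𝓝[>] 0) (𝓝 (t ^ 2)) := by
      have : Continuous fun s : ℝ => t ^ 2 - s ^ 2 * N := by fun_prop
      have := this.tendsto 0
      simp only [ne_eq, OfNat.ofNat_ne_zero, not_false_eq_true, zero_pow, zero_mul, sub_zero] at this
      exact this.mono_left nhdsWithin_le_nhds
    filter_upwards [this.eventually (Ioi_mem_nhds (by positivity : (0 : ℝ) < t ^ 2))] with s hs
    exact ⟨Real.sqrt_nonneg _, Real.sq_sqrt (le_of_lt hs)⟩
  have hdiff : ∀ᶠ s in 𝓝[>] (0 : ℝ), -(ρ s - t) = s ^ 2 * N / (t + ρ s) := by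
    filter_upwards [hsq] with s hs
    have : 0 < t + ρ s := by linarith [hs.1]
    rw [eq_div_iff this.ne']
    nlinarith [hs.2]
  have hlim := hS.tendsto_along w (r := fun s => ρ s - t) (C := N / t) (by
    filter_upwards [hdiff, hpos, hle1, hsq] with s hs hs0 hs1 hsq
    rw [← abs_neg, hs, abs_of_nonneg (by have := hsq.1; positivity)]
    calc s ^ 2 * N / (t + ρ s) ≤ s * N / t := by
          have := hsq.1
          have hNn : 0 ≤ N := by positivity
          gcongr
          · nlinarith
          · linarith
      _ = N / t * s := by ring) (by
    have hcont : Tendsto (fun s : ℝ => t⁻¹ • (s • (w : E n) + ρ s • u)) (𝓝[>] 0) (𝓝 u) := by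
      have hs0 : Tendsto (fun s : ℝ => s) (𝓝[>] 0) (𝓝 0) := nhdsWithin_le_nhds
      have := ((hs0.smul_const (w : E n)).add (hρc.smul_const u)).const_smul t⁻¹
      rwa [zero_smul, zero_add, smul_smul, inv_mul_cancel₀ ht.ne', one_smul] at this
    have hev := hcont.eventually ((isOpen_strictNormalCone hP v).mem_nhds huv)
    filter_upwards [hev, hsq] with s hs hsq
    have heq : v + t • u + s • (w : E n) + (ρ s - t) • u =
        v + t • (t⁻¹ • (s • (w : E n) + ρ s • u)) := by
      rw [smul_smul, mul_inv_cancel₀ ht.ne', one_smul]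
      module
    rw [heq]
    refine mem_frontier_parallel ht.le ?_ hvP (strictNormalCone_subset hP v hs)
    rw [norm_smul, norm_inv, Real.norm_of_nonneg ht.le, inv_mul_eq_one₀ ht.ne', eq_comm]
    refine (sq_eq_sq₀ (norm_nonneg _) ht.le).1 ?_
    rw [norm_add_sq_real, inner_smul_left, inner_smul_right, real_inner_comm,
      inner_coe_orthogonal, norm_smul, norm_smul, hu, mul_pow, mul_pow, Real.norm_eq_abs,
      Real.norm_eq_abs, sq_abs, sq_abs, hsq.2]
    ring)
  have hlim2 : Tendsto (fun s => -(ρ s - t) / s ^ 2) (𝓝[>] 0) (𝓝 (N / (t + t))) := by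
    have h1 : Tendsto (fun s => N / (t + ρ s)) (𝓝[>] 0) (𝓝 (N / (t + t))) :=
      tendsto_const_nhds.div (tendsto_const_nhds.add hρc) (by positivity)
    refine h1.congr' ?_
    filter_upwards [hdiff, hpos] with s hs hs0
    rw [hs]
    field_simp
  have huq := tendsto_nhds_unique hlim hlim2
  rw [LinearMap.sub_apply, LinearMap.smul_apply, LinearMap.id_apply, inner_sub_left,
    inner_smul_left, real_inner_self_eq_norm_sq, conj_trivial, Submodule.coe_norm, ← hN]
  have : inner ℝ (S w) w = N / t := by
    have h2 : N / (t + t) = 1 / 2 * (N / t) := by field_simp; ring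
    rw [h2] at huq
    linarith
  rw [this]
  field_simp
  ring

lemma gaussCurvature_spherical (hP : IsConvexPolytope P) (hPm : P ∈ 𝓝 0) (ht : 0 < t)
    {v u : E n} (hv : v ∈ vert P) (hu : ‖u‖ = 1) (huv : u ∈ strictNormalCone P v) :
    gaussCurvature (P + t • unitBall n) (v + t • u) = t⁻¹ ^ (n - 1) := by
  have hu0 : u ≠ 0 := by rintro rfl; simp at hu
  have hdet : ∀ S, IsWeingartenMap (P + t • unitBall n) (v + t • u)
      (outerNormal (P + t • unitBall n) (v + t • u)) S → LinearMap.det S = t⁻¹ ^ (n - 1) := by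
    rw [outerNormal_parallel ht (extremePoints_subset hv) hu (strictNormalCone_subset hP v huv)]
    intro S hS
    rw [hS.eq_of_spherical hP ht hv hu huv, LinearMap.det_smul, LinearMap.det_id, mul_one,
      finrank_orthogonal_span hu0]
  have hex : ∃ S, IsWeingartenMap (P + t • unitBall n) (v + t • u)
      (outerNormal (P + t • unitBall n) (v + t • u)) S := by
    rw [outerNormal_parallel ht (extremePoints_subset hv) hu (strictNormalCone_subset hP v huv)]
    exact ⟨_, isWeingartenMap_spherical hP hPm ht hv hu huv⟩
  rw [gaussCurvature, dif_pos hex]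
  exact hdet _ hex.choose_spec

end SphericalPart

/-! ### Flat pieces, and the cases `p = 0` and `-n < p < 0`. -/

section SurfaceIntegral

variable {n : ℕ} {P : Set (E n)} {t : ℝ}

lemma parallel_zero (P : Set (E n)) : P + (0 : ℝ) • unitBall n = P := by
  rw [zero_smul_set ⟨0, by simp [unitBall]⟩, add_zero]

lemma face_subset_frontier {u : E n} (hu : ‖u‖ = 1) : face P u ⊆ frontier P := fun _ hz =>
  IsOuterUnitNormal.mem_frontier (u := u) hz.1 ⟨hu, hz.2⟩

/-- Up to a null set, the boundary of a polytope consists of finitely many flat pieces. -/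
lemma exists_flat_decomposition (hn : 1 ≤ n) (hP : IsConvexPolytope P) (h0 : P ∈ 𝓝 0) :
    ∃ F : Set (E n), F.Finite ∧ (∀ u ∈ F, ‖u‖ = 1) ∧ ∃ N : Set (E n), MeasurableSet N ∧
      N ⊆ frontier P ∧ surfaceMeasure n N = 0 ∧ coneMeasure P N = 0 ∧
      frontier P \ N ⊆ ⋃ u ∈ F, flat P u := by
  obtain ⟨F, hF, hF1, hcov⟩ := exists_finite_faces_cover hP
  have hF0 : ∀ u ∈ F, u ≠ 0 := by
    rintro u hu rfl
    simpa using hF1 0 hu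
  have hm : ∀ u ∈ F, MeasurableSet (face P u \ flat P u) := fun u hu =>
    (face_diff_flat hP (hF0 u hu)).1.isClosed.measurableSet
  have hsub : ∀ u ∈ F, face P u \ flat P u ⊆ frontier P := fun u hu =>
    sdiff_subset.trans (face_subset_frontier (hF1 u hu))
  refine ⟨F, hF, hF1, ⋃ u ∈ F, face P u \ flat P u, hF.measurableSet_biUnion hm,
    iUnion₂_subset hsub, ?_, ?_, ?_⟩
  · exact (measure_biUnion_null_iff hF.countable).2 fun u hu => (face_diff_flat hP (hF0 u hu)).2
  · refine (measure_biUnion_null_iff hF.countable).2 fun u hu => ?_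
    rw [coneMeasure_apply hP.convex h0 (hm u hu) (hsub u hu) hP.isCompact.isClosed]
    rcases (face P u \ flat P u).eq_empty_or_nonempty with he | ⟨y, hy⟩
    · rw [he]
      simp [cone]
    · obtain ⟨ρ, hρ, hball⟩ := Metric.mem_nhds_iff.1 h0
      have hpos : ρ / 2 ≤ inner ℝ u y :=
        IsOuterUnitNormal.le_inner ⟨hF1 u hu, hy.1.2⟩ (by positivity)
          ((closedBall_subset_ball (by linarith)).trans hball)
      have := volume_cone_of_flat hn (hm u hu) (hF1 u hu) (h := inner ℝ u y) (by linarith)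
        fun z hz => inner_eq_of_mem_face hz.1 hy.1
      rw [(face_diff_flat hP (hF0 u hu)).2, mul_zero, mul_eq_zero] at this
      refine this.resolve_left ?_
      exact_mod_cast (by omega : n ≠ 0)
  · rintro x ⟨hx, hxN⟩
    obtain ⟨u, hu⟩ := exists_isOuterUnitNormal hP.convex h0 hx
    obtain ⟨u', hu', hface⟩ := hcov u hu.1
    have hxf : x ∈ face P u' := hface ▸ ⟨hP.isCompact.isClosed.frontier_subset hx, hu.2⟩
    refine mem_iUnion₂.2 ⟨u', hu', ?_⟩
    by_contra hcon
    exact hxN (mem_iUnion₂.2 ⟨u', hu', hxf, hcon⟩)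

lemma flat_self (hn : 2 ≤ n) (h0 : P ∈ 𝓝 0) {y u : E n} (hu : ‖u‖ = 1) (hy : y ∈ flat P u) :
    (∀ u', IsOuterUnitNormal P y u' → u' = u) ∧ gaussCurvature P y = 0 := by
  have := flat_parallel hn h0 le_rfl hu hy
  rwa [parallel_zero, zero_smul, add_zero] at this

/-- The cone volume formula needs unique normals; the discarded set is null for the surface measure
and for the cone measure, so neither side changes. -/
lemma lintegral_inner_outerNormal_polytope (hn : 2 ≤ n) (hP : IsConvexPolytope P) (h0 : P ∈ 𝓝 0) :
    ∫⁻ x in frontier P, ENNReal.ofReal (inner ℝ x (outerNormal P x)) ∂(surfaceMeasure n) =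
      n * volume P := by
  have hn1 : 1 ≤ n := by omega
  obtain ⟨F, hF, hF1, N, hN, hNP, hN0, hNc, hcov⟩ := exists_flat_decomposition hn1 hP h0
  have hfr : MeasurableSet (frontier P) := isClosed_frontier.measurableSet
  have key := setLIntegral_inner_outerNormal hn1 hP.convex hP.isCompact h0 (hfr.diff hN)
    sdiff_subset (fun x hx => by
      obtain ⟨u, hu, hxu⟩ := mem_iUnion₂.1 (hcov hx)
      exact ⟨u, ⟨hF1 u hu, (flat_subset_face P u hxu).2⟩,
        (flat_self hn h0 (hF1 u hu) hxu).1⟩)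
  rw [measure_sdiff_null hNc, coneMeasure_frontier hn1 hP.convex hP.isCompact h0] at key
  rw [← key, ← lintegral_inter_add_sdiff _ (frontier P) hN,
    setLIntegral_measure_zero _ _ (measure_mono_null inter_subset_right hN0), zero_add]

lemma lintegral_inner_outerNormal_parallel (hn : 2 ≤ n) (hP : IsConvexPolytope P)
    (h0 : P ∈ 𝓝 0) (ht : 0 ≤ t) :
    ∫⁻ x in frontier (P + t • unitBall n),
      ENNReal.ofReal (inner ℝ x (outerNormal (P + t • unitBall n) x)) ∂(surfaceMeasure n) =
      n * volume (P + t • unitBall n) := by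
  rcases ht.eq_or_lt with rfl | ht
  · rw [parallel_zero]
    exact lintegral_inner_outerNormal_polytope hn hP h0
  · have hc := convex_parallel hP.convex t
    have hK := isCompact_parallel hP.isCompact t
    have h0' : P + t • unitBall n ∈ 𝓝 0 := mem_of_superset h0 (subset_parallel P t)
    rw [setLIntegral_inner_outerNormal (by omega) hc hK h0' isClosed_frontier.measurableSet
      subset_rfl, coneMeasure_frontier (by omega) hc hK h0']
    intro x hx
    obtain ⟨y, hy, u, hu, rfl, huy⟩ := exists_eq_of_mem_frontier_parallel hP.convex hP.isCompact
      h0 ht.le hx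
    exact ⟨u, isOuterUnitNormal_parallel ht.le hu huy,
      fun u' hu' => unique_normal_parallel ht hy hu huy hu'⟩

lemma Lpasa_zero_parallel (hn : 2 ≤ n) (hP : IsConvexPolytope P) (h0 : P ∈ 𝓝 0) (ht : 0 ≤ t) :
    Lpasa 0 (P + t • unitBall n) = n * volume (P + t • unitBall n) := by
  rw [← lintegral_inner_outerNormal_parallel hn hP h0 ht, Lpasa]
  refine lintegral_congr fun x => ?_
  have hn0 : (n : ℝ) ≠ 0 := by
    have : n ≠ 0 := by omega
    exact_mod_cast this
  have h1 : (n : ℝ) * (0 - 1) / (n + 0) = -1 := by field_simp; ring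
  rw [zero_div, ENNReal.rpow_zero, h1, ENNReal.rpow_neg_one, one_div, inv_inv]

/-- Otherwise the boundary would be null, and the cone volume formula would give `P` volume `0`. -/
lemma exists_flat_pos (hn : 2 ≤ n) (hP : IsConvexPolytope P) (h0 : P ∈ 𝓝 0) :
    ∃ u, ‖u‖ = 1 ∧ surfaceMeasure n (flat P u) ≠ 0 := by
  have hn1 : 1 ≤ n := by omega
  by_contra! hcon
  obtain ⟨F, hF, hF1, N, hN, hNP, hN0, hNc, hcov⟩ := exists_flat_decomposition hn1 hP h0
  have hzero : surfaceMeasure n (frontier P) = 0 := by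
    have hsub : frontier P ⊆ N ∪ ⋃ u ∈ F, flat P u := fun x hx => by
      by_cases hxN : x ∈ N
      · exact Or.inl hxN
      · exact Or.inr (hcov ⟨hx, hxN⟩)
    refine measure_mono_null hsub (measure_union_null hN0 ?_)
    exact (measure_biUnion_null_iff hF.countable).2 fun u hu => hcon u (hF1 u hu)
  have := lintegral_inner_outerNormal_polytope hn hP h0
  rw [setLIntegral_measure_zero _ _ hzero, eq_comm, mul_eq_zero] at this
  rcases this with h | h
  · exact absurd h (by exact_mod_cast (by omega : n ≠ 0))
  · exact (Measure.measure_pos_of_mem_nhds volume h0).ne' h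

/-- On the translate by `t • u` of a flat piece of positive area the numerator is `0` to a negative
power, while the denominator is finite. -/
lemma Lpasa_eq_top_parallel (hn : 2 ≤ n) (hP : IsConvexPolytope P) (h0 : P ∈ 𝓝 0) (ht : 0 ≤ t)
    {p : ℝ} (hp : p ∈ Ioo (-(n : ℝ)) 0) : Lpasa p (P + t • unitBall n) = ∞ := by
  obtain ⟨u, hu, hpos⟩ := exists_flat_pos hn hP h0
  have hu0 : u ≠ 0 := by rintro rfl; simp at hu
  set T := (fun y => y + t • u) '' flat P u with hT
  have hTm : MeasurableSet T :=
    (MeasurableEquiv.addRight (t • u)).measurableEmbedding.measurableSet_image.2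
      (measurableSet_flat hP hu0)
  have hTpos : surfaceMeasure n T ≠ 0 := by
    rw [hT, surfaceMeasure, (isometry_add_right (t • u)).euclideanHausdorffMeasure_image]
    exact hpos
  have hTK : T ⊆ frontier (P + t • unitBall n) := by
    rintro _ ⟨y, hy, rfl⟩
    have hyf := flat_subset_face P u hy
    exact mem_frontier_parallel ht hu hyf.1 hyf.2
  rw [Lpasa, eq_top_iff]
  calc (∞ : ℝ≥0∞) = ∫⁻ _ in T, ∞ ∂(surfaceMeasure n) := by
        rw [setLIntegral_const, ENNReal.top_mul hTpos]
    _ ≤ ∫⁻ x in T, ENNReal.ofReal (gaussCurvature (P + t • unitBall n) x) ^ (p / (n + p)) /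
          ENNReal.ofReal (inner ℝ x (outerNormal (P + t • unitBall n) x)) ^ (n * (p - 1) / (n + p))
          ∂(surfaceMeasure n) := by
        refine setLIntegral_mono' hTm ?_
        rintro _ ⟨y, hy, rfl⟩
        have hyf := flat_subset_face P u hy
        obtain ⟨huniq, hcurv⟩ := flat_parallel hn h0 ht hu hy
        have hnor := isOuterUnitNormal_parallel ht hu hyf.2
        obtain ⟨ρ, hρ, hball⟩ := Metric.mem_nhds_iff.1 h0
        have hin : ρ / 2 ≤ inner ℝ u (y + t • u) := hnor.le_inner (by positivity)
          (((closedBall_subset_ball (by linarith)).trans hball).trans (subset_parallel P t))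
        simp only
        rw [hcurv, outerNormal_eq hnor huniq, ENNReal.ofReal_zero, ENNReal.zero_rpow_of_neg,
          ENNReal.top_div_of_ne_top]
        · refine ENNReal.rpow_ne_top_of_ne_zero ?_ ENNReal.ofReal_ne_top
          rw [real_inner_comm, ne_eq, ENNReal.ofReal_eq_zero, not_le]
          linarith
        · exact div_neg_of_neg_of_pos hp.2 (by linarith [hp.1])
    _ ≤ _ := lintegral_mono_set hTK

lemma Lpasa_polytope_eq_zero (hn : 2 ≤ n) (hP : IsConvexPolytope P) (h0 : P ∈ 𝓝 0) {p : ℝ}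
    (hp : 0 < p / (n + p)) : Lpasa p P = 0 := by
  obtain ⟨F, hF, hF1, N, hN, hNP, hN0, hNc, hcov⟩ := exists_flat_decomposition (by omega) hP h0
  have hfr : MeasurableSet (frontier P) := isClosed_frontier.measurableSet
  rw [Lpasa, ← lintegral_inter_add_sdiff _ (frontier P) hN,
    setLIntegral_measure_zero _ _ (measure_mono_null inter_subset_right hN0), zero_add]
  refine (setLIntegral_congr_fun (hfr.diff hN) fun x hx => ?_).trans lintegral_zero
  obtain ⟨u, hu, hxu⟩ := mem_iUnion₂.1 (hcov hx)
  rw [(flat_self hn h0 (hF1 u hu) hxu).2, ENNReal.ofReal_zero, ENNReal.zero_rpow_of_pos hp,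
    ENNReal.zero_div]

end SurfaceIntegral

/-! ### Integration over the normal cones and the binomial expansion. -/

section SphericalIntegral

variable {n : ℕ} {P : Set (E n)} {t : ℝ}

lemma isCompact_sphere_inter_normalCone (P : Set (E n)) (v : E n) :
    IsCompact (unitSphere n ∩ normalCone P v) := by
  refine (isCompact_sphere (0 : E n) 1).inter_right ?_
  have : normalCone P v = ⋂ z ∈ P, {u | inner ℝ u (z - v) ≤ 0} := by
    ext u
    simp [normalCone]
  rw [this]
  exact isClosed_biInter fun z _ => isClosed_le (by fun_prop) (by fun_prop)

lemma norm_of_mem_sphere_inter {v u : E n} (hu : u ∈ unitSphere n ∩ normalCone P v) : ‖u‖ = 1 := by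
  simpa [unitSphere] using hu.1

lemma integrableOn_sphere_inter_normalCone (hn : 1 ≤ n) {v : E n} {f : E n → ℝ}
    (hf : ContinuousOn f (unitSphere n ∩ normalCone P v)) :
    IntegrableOn f (unitSphere n ∩ normalCone P v) (surfaceMeasure n) := by
  have : IsFiniteMeasure ((surfaceMeasure n).restrict (unitSphere n)) :=
    ⟨by rw [Measure.restrict_apply_univ]; exact surfaceMeasure_unitSphere_lt_top hn⟩
  have h := hf.integrableOn_compact (μ := (surfaceMeasure n).restrict (unitSphere n))
    (isCompact_sphere_inter_normalCone P v)
  rwa [IntegrableOn, Measure.restrict_restrict_of_subset inter_subset_left] at h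

lemma continuousOn_supportFn {v : E n} (hv : v ∈ P) :
    ContinuousOn (supportFn P) (unitSphere n ∩ normalCone P v) :=
  (by fun_prop : Continuous fun u : E n => inner ℝ v u).continuousOn.congr
    fun _ hu => supportFn_eq_inner hv hu.2

lemma measurePreserving_homothety (v : E n) (ht : 0 < t) :
    MeasurePreserving (fun u => v + t • u) (ENNReal.ofReal (t ^ (n - 1)) • surfaceMeasure n)
      (surfaceMeasure n) := by
  have hmeas : Measurable fun u : E n => v + t • u := by fun_prop
  refine ⟨hmeas, Measure.ext fun A hA => ?_⟩
  rw [Measure.map_apply hmeas hA, Measure.smul_apply, smul_eq_mul]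
  have h1 : A = (fun z => v + z) '' (t • ((fun u => v + t • u) ⁻¹' A)) := by
    ext z
    constructor
    · intro hz
      refine ⟨z - v, ⟨t⁻¹ • (z - v), ?_, ?_⟩, add_sub_cancel _ _⟩
      · rw [mem_preimage, smul_smul, mul_inv_cancel₀ ht.ne', one_smul, add_sub_cancel]
        exact hz
      · simp only
        rw [smul_smul, mul_inv_cancel₀ ht.ne', one_smul]
    · rintro ⟨_, ⟨u, hu, rfl⟩, rfl⟩
      exact hu
  have h2 : surfaceMeasure n A = surfaceMeasure n (t • ((fun u => v + t • u) ⁻¹' A)) := by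
    nth_rewrite 1 [h1]
    rw [surfaceMeasure, (isometry_add_left v).euclideanHausdorffMeasure_image]
  rw [h2, surfaceMeasure, Measure.euclideanHausdorffMeasure_smul₀ _ ht.ne', ENNReal.smul_def,
    smul_eq_mul, ENNReal.ofReal_pow ht.le, ENNReal.coe_pow]
  congr 2
  exact (Real.enorm_of_nonneg ht.le).symm

lemma measurableEmbedding_homothety (v : E n) (ht : 0 < t) :
    MeasurableEmbedding fun u : E n => v + t • u :=
  (MeasurableEquiv.addLeft v).measurableEmbedding.comp
    (MeasurableEquiv.smul₀ t ht.ne').measurableEmbedding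

/-- The exceptional directions are orthogonal to `v' - v` for some other vertex `v'`, hence lie in
finitely many null great subspheres. -/
lemma ae_mem_strictNormalCone (hP : IsConvexPolytope P) (v : E n) :
    ∀ᵐ u ∂(surfaceMeasure n).restrict (unitSphere n ∩ normalCone P v),
      u ∈ strictNormalCone P v := by
  rw [ae_restrict_iff' (isCompact_sphere_inter_normalCone P v).measurableSet]
  refine measure_mono_null (t := ⋃ v' ∈ vert P \ {v}, unitSphere n ∩ {u | inner ℝ (v' - v) u = 0})
    ?_ ?_
  · intro u hu
    simp only [mem_compl_iff, mem_ofPred_eq, Classical.not_imp, strictNormalCone,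
      not_forall, not_lt] at hu
    obtain ⟨⟨hu1, hu2⟩, v', hv', hne, hle⟩ := hu
    refine mem_iUnion₂.2 ⟨v', ⟨hv', hne⟩, hu1, ?_⟩
    rw [mem_ofPred_eq, real_inner_comm]
    exact le_antisymm (hu2 v' (extremePoints_subset hv')) hle
  · refine (measure_biUnion_null_iff (hP.finite_vert.subset sdiff_subset).countable).2
      fun v' hv' => surfaceMeasure_sphere_inter_hyperplane (sub_ne_zero.2 hv'.2)

lemma hasSum_choose_mul_pow (a : ℝ) {x : ℝ} (hx : |x| < 1) :
    HasSum (fun m : ℕ => Ring.choose a m * x ^ m) ((1 + x) ^ a) := by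
  have h := (Real.one_add_rpow_hasFPowerSeriesOnBall_zero (a := a)).hasSum (y := x)
    (by
      rw [Metric.mem_eball, edist_zero_right, ← ofReal_norm, Real.norm_eq_abs]
      simpa using hx)
  simpa only [binomialSeries_apply, List.ofFn_const, List.prod_replicate, zero_add, smul_eq_mul]
    using h

variable {β : ℝ}

/-- Factor out `h^a` and expand `(1 + t/h)^a`. Since `t/h ≤ t/β < 1`, the terms are dominated by
`h^a` times a convergent numerical series, so sum and integral may be exchanged. -/
lemma hasSum_integral_binomial (hn : 1 ≤ n) (a : ℝ) {v : E n} (hv : v ∈ P) (ht : 0 ≤ t)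
    (htβ : t < β) (hβ : ∀ u, ‖u‖ = 1 → β ≤ supportFn P u) :
    HasSum (fun m : ℕ => Ring.choose a m *
        (∫ u in unitSphere n ∩ normalCone P v, supportFn P u ^ (a - m) ∂(surfaceMeasure n)) * t ^ m)
      (∫ u in unitSphere n ∩ normalCone P v, (supportFn P u + t) ^ a ∂(surfaceMeasure n)) := by
  set Ω := unitSphere n ∩ normalCone P v with hΩ
  have hβ0 : 0 < β := ht.trans_lt htβ
  have hΩm : MeasurableSet Ω := (isCompact_sphere_inter_normalCone P v).measurableSet
  have hpos : ∀ u ∈ Ω, 0 < supportFn P u := fun u hu =>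
    hβ0.trans_le (hβ u (norm_of_mem_sphere_inter hu))
  have hint : ∀ c : ℝ, IntegrableOn (fun u => supportFn P u ^ c) Ω (surfaceMeasure n) := fun c =>
    integrableOn_sphere_inter_normalCone hn
      ((continuousOn_supportFn hv).rpow_const fun u hu => Or.inl (hpos u hu).ne')
  have hxle : ∀ u ∈ Ω, t / supportFn P u ≤ t / β := fun u hu =>
    div_le_div_of_nonneg_left ht hβ0 (hβ u (norm_of_mem_sphere_inter hu))
  have hx1 : t / β < 1 := (div_lt_one hβ0).2 htβ
  have hx0 : 0 ≤ t / β := by positivity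
  have hterm : ∀ (m : ℕ), ∀ u ∈ Ω, Ring.choose a m * supportFn P u ^ (a - m) * t ^ m =
      supportFn P u ^ a * (Ring.choose a m * (t / supportFn P u) ^ m) := by
    intro m u hu
    rw [Real.rpow_sub (hpos u hu), Real.rpow_natCast, div_pow]
    have := (pow_pos (hpos u hu) m).ne'
    field_simp
  have hsum : Summable fun m : ℕ => |Ring.choose a m| * (t / β) ^ m := by
    have := (hasSum_choose_mul_pow a (by rwa [abs_of_nonneg hx0])).summable.abs
    simpa only [abs_mul, abs_pow, abs_of_nonneg hx0] using this
  have key := hasSum_integral_of_summable_integral_norm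
    (μ := (surfaceMeasure n).restrict Ω)
    (F := fun (m : ℕ) u => Ring.choose a m * supportFn P u ^ (a - m) * t ^ m)
    (fun m => ((hint (a - m)).const_mul _).mul_const _) (by
      refine Summable.of_nonneg_of_le (fun m => integral_nonneg fun u => norm_nonneg _)
        (fun m => ?_) (hsum.mul_right (∫ u in Ω, supportFn P u ^ a ∂(surfaceMeasure n)))
      rw [← integral_const_mul]
      refine setIntegral_mono_on (((hint (a - m)).const_mul _).mul_const _).norm
        ((hint a).const_mul _) hΩm fun u hu => ?_
      rw [hterm m u hu, Real.norm_eq_abs, abs_mul, abs_mul, abs_pow,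
        abs_of_pos (Real.rpow_pos_of_pos (hpos u hu) a),
        abs_of_nonneg (div_nonneg ht (hpos u hu).le), mul_comm]
      have := (Real.rpow_pos_of_pos (hpos u hu) a).le
      have h0 := div_nonneg ht (hpos u hu).le
      gcongr
      exact hβ u (norm_of_mem_sphere_inter hu))
  have hval : ∫ u in Ω, (∑' m : ℕ, Ring.choose a m * supportFn P u ^ (a - m) * t ^ m)
      ∂(surfaceMeasure n) = ∫ u in Ω, (supportFn P u + t) ^ a ∂(surfaceMeasure n) := by
    refine setIntegral_congr_fun hΩm fun u hu => ?_
    have h0 := div_nonneg ht (hpos u hu).le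
    have h1 := (hasSum_choose_mul_pow a (x := t / supportFn P u)
      (by rw [abs_of_nonneg h0]; exact (hxle u hu).trans_lt hx1)).mul_left (supportFn P u ^ a)
    simp only [← hterm _ u hu] at h1
    rw [h1.tsum_eq, ← Real.mul_rpow (hpos u hu).le (by positivity)]
    congr 1
    have := (hpos u hu).ne'
    field_simp
  rw [hval] at key
  refine key.congr_fun fun m => ?_
  rw [integral_mul_const, integral_const_mul]

/-- The contribution of the vertex `v`. -/
lemma lintegral_spherical (hP : IsConvexPolytope P) (h0 : P ∈ 𝓝 0) (hn : 1 ≤ n) (ht : 0 < t)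
    (hβ : ∀ u, ‖u‖ = 1 → 0 < supportFn P u) {v : E n} (hv : v ∈ vert P) {p : ℝ} (hp : n + p ≠ 0) :
    ∫⁻ x in (fun u => v + t • u) '' (unitSphere n ∩ normalCone P v),
      ENNReal.ofReal (gaussCurvature (P + t • unitBall n) x) ^ (p / (n + p)) /
        ENNReal.ofReal (inner ℝ x (outerNormal (P + t • unitBall n) x)) ^ (n * (p - 1) / (n + p))
      ∂(surfaceMeasure n) =
    ENNReal.ofReal (t ^ (n * (n - 1) / (n + p) : ℝ) *
      ∫ u in unitSphere n ∩ normalCone P v, (supportFn P u + t) ^ (n * (1 - p) / (n + p))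
        ∂(surfaceMeasure n)) := by
  set Ω := unitSphere n ∩ normalCone P v with hΩ
  set a := (n : ℝ) * (1 - p) / (n + p) with ha
  have hvP : v ∈ P := extremePoints_subset hv
  have hΩm : MeasurableSet Ω := (isCompact_sphere_inter_normalCone P v).measurableSet
  have hpos : ∀ u ∈ Ω, 0 < supportFn P u + t := fun u hu => by
    have := hβ u (norm_of_mem_sphere_inter hu)
    linarith
  have hint : IntegrableOn (fun u => (supportFn P u + t) ^ a) Ω (surfaceMeasure n) :=
    integrableOn_sphere_inter_normalCone hn
      (((continuousOn_supportFn hvP).add continuousOn_const).rpow_const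
        fun u hu => Or.inl (hpos u hu).ne')
  rw [← (measurePreserving_homothety v ht).setLIntegral_comp_emb
    (measurableEmbedding_homothety v ht), Measure.restrict_smul, lintegral_smul_measure,
    smul_eq_mul]
  have hcongr : ∫⁻ u in Ω,
      ENNReal.ofReal (gaussCurvature (P + t • unitBall n) (v + t • u)) ^ (p / (n + p)) /
        ENNReal.ofReal (inner ℝ (v + t • u) (outerNormal (P + t • unitBall n) (v + t • u))) ^
          (n * (p - 1) / (n + p)) ∂(surfaceMeasure n) =
      ∫⁻ u in Ω, ENNReal.ofReal ((t⁻¹ ^ (n - 1)) ^ (p / (n + p))) *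
        ENNReal.ofReal ((supportFn P u + t) ^ a) ∂(surfaceMeasure n) := by
    refine lintegral_congr_ae ?_
    filter_upwards [ae_mem_strictNormalCone hP v, ae_restrict_mem hΩm] with u hu huΩ
    have hu1 := norm_of_mem_sphere_inter huΩ
    have hin : inner ℝ (v + t • u) u = supportFn P u + t := by
      rw [inner_add_left, inner_smul_left, real_inner_self_eq_norm_sq, hu1,
        supportFn_eq_inner hvP huΩ.2]
      simp
    have hexp : (n : ℝ) * (p - 1) / (n + p) = -a := by rw [ha]; ring
    rw [gaussCurvature_spherical hP h0 ht hv hu1 hu, outerNormal_parallel ht hvP hu1 huΩ.2, hin,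
      hexp, ENNReal.rpow_neg, ENNReal.div_eq_inv_mul, inv_inv, mul_comm,
      ENNReal.ofReal_rpow_of_pos (by positivity), ENNReal.ofReal_rpow_of_pos (hpos u huΩ)]
  have hnonneg : 0 ≤ᵐ[(surfaceMeasure n).restrict Ω] fun u => (supportFn P u + t) ^ a := by
    filter_upwards [ae_restrict_mem hΩm] with u hu
    exact (Real.rpow_pos_of_pos (hpos u hu) a).le
  rw [hcongr, lintegral_const_mul' _ _ ENNReal.ofReal_ne_top,
    ← ofReal_integral_eq_lintegral_ofReal hint hnonneg, ← mul_assoc,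
    ← ENNReal.ofReal_mul (by positivity), ← ENNReal.ofReal_mul (by positivity)]
  congr 2
  -- The Jacobian and the curvature combine by `(n-1) - (n-1)p/(n+p) = n(n-1)/(n+p)`.
  rw [inv_pow, ← Real.rpow_natCast, ← Real.rpow_neg ht.le, ← Real.rpow_mul ht.le,
    ← Real.rpow_add ht, Nat.cast_sub hn, Nat.cast_one]
  congr 1
  field_simp
  ring

/-- The spherical pieces of different vertices are disjoint, because a boundary point determines its
point of `P`; off them the curvature is `0` and its exponent is positive. -/
lemma Lpasa_parallel_eq_sum (hP : IsConvexPolytope P) (h0 : P ∈ 𝓝 0) (hn : 1 ≤ n) (ht : 0 < t)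
    (hβ : ∀ u, ‖u‖ = 1 → 0 < supportFn P u) {p : ℝ} (hp : 0 < p / (n + p)) :
    Lpasa p (P + t • unitBall n) = ENNReal.ofReal (t ^ (n * (n - 1) / (n + p) : ℝ) *
      ∑ v ∈ hP.finite_vert.toFinset, ∫ u in unitSphere n ∩ normalCone P v,
        (supportFn P u + t) ^ (n * (1 - p) / (n + p)) ∂(surfaceMeasure n)) := by
  have hp0 : n + p ≠ 0 := by
    intro h
    rw [h, div_zero] at hp
    exact lt_irrefl _ hp
  set A : E n → Set (E n) := fun v => (fun u => v + t • u) '' (unitSphere n ∩ normalCone P v)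
    with hA
  have hAm : ∀ v, MeasurableSet (A v) := fun v =>
    ((isCompact_sphere_inter_normalCone P v).image (by fun_prop)).measurableSet
  set V := hP.finite_vert.toFinset with hV
  have hVP : ∀ v ∈ V, v ∈ vert P := fun v hv => by simpa [hV] using hv
  have hUm : MeasurableSet (⋃ v ∈ V, A v) := V.measurableSet_biUnion fun v _ => hAm v
  have hUK : ⋃ v ∈ V, A v ⊆ frontier (P + t • unitBall n) := by
    refine iUnion₂_subset fun v hv => ?_
    rintro _ ⟨u, hu, rfl⟩
    exact mem_frontier_parallel ht.le (norm_of_mem_sphere_inter hu)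
      (extremePoints_subset (hVP v hv)) hu.2
  have hdisj : (V : Set (E n)).PairwiseDisjoint A := by
    intro v hv v' hv' hne
    refine disjoint_left.2 ?_
    rintro _ ⟨u, hu, rfl⟩ ⟨u', hu', heq⟩
    exact hne (eq_of_parallel_eq ht (extremePoints_subset (hVP v hv)) hu.2
      (extremePoints_subset (hVP v' hv')) hu'.2 heq).2.symm
  rw [Lpasa, ← lintegral_inter_add_sdiff _ (frontier (P + t • unitBall n)) hUm,
    inter_eq_self_of_subset_right hUK, lintegral_biUnion_finset hdisj (fun v _ => hAm v)]
  have hrest : ∫⁻ x in frontier (P + t • unitBall n) \ ⋃ v ∈ V, A v,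
      ENNReal.ofReal (gaussCurvature (P + t • unitBall n) x) ^ (p / (n + p)) /
        ENNReal.ofReal (inner ℝ x (outerNormal (P + t • unitBall n) x)) ^ (n * (p - 1) / (n + p))
      ∂(surfaceMeasure n) = 0 := by
    refine (setLIntegral_congr_fun (isClosed_frontier.measurableSet.diff hUm)
      fun x hx => ?_).trans lintegral_zero
    obtain ⟨hxK, hxU⟩ := hx
    obtain ⟨y, hy, u, hu, rfl, huy⟩ := exists_eq_of_mem_frontier_parallel hP.convex hP.isCompact
      h0 ht.le hxK
    have hyv : y ∉ vert P := fun hyv => hxU (mem_iUnion₂.2 ⟨y, by simpa [hV] using hyv, u,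
      ⟨by simpa [unitSphere] using hu, huy⟩, rfl⟩)
    rw [gaussCurvature_parallel_of_not_vert hP.isCompact hP.convex ht hy hu huy hyv,
      ENNReal.ofReal_zero, ENNReal.zero_rpow_of_pos hp, ENNReal.zero_div]
  rw [hrest, add_zero, Finset.sum_congr rfl fun v hv =>
    lintegral_spherical hP h0 hn ht hβ (hVP v hv) hp0, ← ENNReal.ofReal_sum_of_nonneg,
    Finset.mul_sum]
  intro v _
  refine mul_nonneg (by positivity) (setIntegral_nonneg
    (isCompact_sphere_inter_normalCone P v).measurableSet fun u hu => ?_)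
  have := hβ u (norm_of_mem_sphere_inter hu)
  positivity

end SphericalIntegral

end LpSteiner

/-! ### The Steiner formula. -/

theorem mainTheorem7 {n : ℕ} (hn : 2 ≤ n) (P : Set (LpSteiner.E n))
    (hP : LpSteiner.IsConvexPolytope P) (t : ℝ) (ht : 0 ≤ t) (htP : t < LpSteiner.beta P) :
    -- (i)
    (∀ p : ℝ, p ∉ Icc (-(n : ℝ)) 0 → (p < -(n : ℝ) → 0 < t) →
      (∀ (m : ℕ), ∀ v ∈ LpSteiner.vert P,
        IntegrableOn (fun u => LpSteiner.supportFn P u ^ (n * (1 - p) / (n + p) - m))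
          (LpSteiner.unitSphere n ∩ LpSteiner.normalCone P v) (LpSteiner.surfaceMeasure n)) ∧
      LpSteiner.Lpasa p (P + t • LpSteiner.unitBall n) ≠ ∞ ∧
      HasSum
        (fun m : ℕ =>
          Ring.choose (n * (1 - p) / (n + p)) m *
            (∑ᶠ v ∈ LpSteiner.vert P,
              ∫ u in LpSteiner.unitSphere n ∩ LpSteiner.normalCone P v,
                LpSteiner.supportFn P u ^ (n * (1 - p) / (n + p) - m)
                ∂(LpSteiner.surfaceMeasure n)) *
            t ^ (m + n * (n - 1) / (n + p)))
        (LpSteiner.Lpasa p (P + t • LpSteiner.unitBall n)).toReal) ∧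
    -- (ii)
    (∀ p : ℝ, p ∈ Ioo (-(n : ℝ)) 0 →
      LpSteiner.Lpasa p (P + t • LpSteiner.unitBall n) = ∞) ∧
    -- (iii)
    LpSteiner.Lpasa 0 (P + t • LpSteiner.unitBall n)
      = n * volume (P + t • LpSteiner.unitBall n) := by
  have hn1 : 1 ≤ n := by omega
  have hβ : 0 < LpSteiner.beta P := ht.trans_lt htP
  have hne := LpSteiner.nonempty_of_beta_pos hβ
  have h0 : P ∈ 𝓝 0 := mem_of_superset (ball_mem_nhds 0 hβ)
    (LpSteiner.ball_beta_subset hP.convex hP.isCompact hβ)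
  have hle : ∀ u, ‖u‖ = 1 → LpSteiner.beta P ≤ LpSteiner.supportFn P u := fun u hu =>
    LpSteiner.beta_le_supportFn hP.isCompact hne hu
  have hpos : ∀ u, ‖u‖ = 1 → 0 < LpSteiner.supportFn P u := fun u hu => hβ.trans_le (hle u hu)
  refine ⟨fun p hp hpt => ?_, fun p hp => LpSteiner.Lpasa_eq_top_parallel hn hP h0 ht hp,
    LpSteiner.Lpasa_zero_parallel hn hP h0 ht⟩
  have hn0 : (1 : ℝ) < n := by exact_mod_cast hn
  have hpe : 0 < p / (n + p) := by
    rw [mem_Icc, not_and_or, not_le, not_le] at hp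
    rcases hp with hp | hp
    · exact div_pos_of_neg_of_neg (by linarith) (by linarith)
    · positivity
  refine ⟨fun m v hv => ?_, ?_⟩
  · exact LpSteiner.integrableOn_sphere_inter_normalCone hn1
      ((LpSteiner.continuousOn_supportFn (extremePoints_subset hv)).rpow_const
        fun u hu => Or.inl (hpos u (LpSteiner.norm_of_mem_sphere_inter hu)).ne')
  -- If `t = 0` then `p > 0`, so every exponent of `t` is positive, including that for `m = 0`; both
  -- sides vanish.
  rcases ht.eq_or_lt with rfl | ht
  · have hp0 : 0 < p := by
      rw [mem_Icc, not_and_or, not_le, not_le] at hp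
      exact hp.resolve_left fun h => lt_irrefl _ (hpt h)
    rw [LpSteiner.parallel_zero, LpSteiner.Lpasa_polytope_eq_zero hn hP h0 hpe]
    refine ⟨ENNReal.zero_ne_top, ?_⟩
    have hz : ∀ m : ℕ, (0 : ℝ) ^ ((m : ℝ) + n * (n - 1) / (n + p)) = 0 := fun m => by
      refine Real.zero_rpow (ne_of_gt ?_)
      have : 0 < (n : ℝ) * (n - 1) / (n + p) :=
        div_pos (mul_pos (by linarith) (by linarith)) (by linarith)
      positivity
    simp only [hz, mul_zero, ENNReal.toReal_zero]
    exact hasSum_zero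
  · rw [LpSteiner.Lpasa_parallel_eq_sum hP h0 hn1 ht hpos hpe]
    refine ⟨ENNReal.ofReal_ne_top, ?_⟩
    rw [ENNReal.toReal_ofReal]
    · have hs := (hasSum_sum fun v (hv : v ∈ hP.finite_vert.toFinset) =>
        LpSteiner.hasSum_integral_binomial hn1 ((n : ℝ) * (1 - p) / (n + p))
          (extremePoints_subset (hP.finite_vert.mem_toFinset.1 hv)) ht.le htP hle).mul_left
        (t ^ ((n : ℝ) * (n - 1) / (n + p)))
      refine hs.congr_fun fun m => ?_
      rw [finsum_mem_eq_finite_toFinset_sum _ hP.finite_vert, Real.rpow_add ht, Real.rpow_natCast,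
        ← Finset.sum_mul, ← Finset.mul_sum]
      ring
    · refine mul_nonneg (by positivity) (Finset.sum_nonneg fun v _ => setIntegral_nonneg
        (LpSteiner.isCompact_sphere_inter_normalCone P v).measurableSet fun u hu => ?_)
      have := hpos u (LpSteiner.norm_of_mem_sphere_inter hu)
      positivity
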